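/- Null-form estimates for free Dirac waves. Notation. Let $m\ge 0$, $\langle\xi\rangle_m=\sqrt{m^2+|\xi|^2}$ and $\widehat f(\xi)=\mathcal F_x f(\xi)=\int_{\mathbb R^3}e^{-ix\cdot\xi}f(x)\,dx$. For $t\in\mathbb R$ let $S_m(t)=e^{-it\langle D\rangle_m}$, i.e. $\widehat{S_m(t)f}(\xi)=e^{-it\langle\xi\rangle_m}\widehat f(\xi)$. Fix an even $\chi\in C_0^\infty((-2,2))$ with $\chi=1$ on $[-1,1]$; put $\rho_1=\chi$, $\rho_\lambda(s)=\chi(s/\lambda)-\chi(2s/\lambda)$ for $\lambda>1$, $P_\lambda f=\mathcal F_x^{-1}[\rho_\lambda(|\xi|)\widehat f(\xi)]$ and $f_\lambda=P_\lambda f$. Let $\sigma^1,\sigma^2,\sigma^3$ be the Pauli matrices, $$\beta=\begin{pmatrix}I&0\\0&-I\end{pmatrix},\qquad \alpha^j=\begin{pmatrix}0&\sigma^j\\ \sigma^j&0\end{pmatrix},\qquad S^l=\begin{pmatrix}\sigma^l&0\\0&\sigma^l\end{pmatrix},$$ write $\hat\eta=\langle\eta\rangle_m^{-1}\eta$ for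 a frequency $\eta\in\mathbb R^3$, and set $$q_1^\pm(\eta,\zeta)=(|\hat\eta||\hat\zeta|\mp\hat\eta\cdot\hat\zeta)I,\qquad q_2^\pm(\eta,\zeta)=-(\hat\eta|\hat\zeta|\mp\hat\zeta|\hat\eta|)\cdot\boldsymbol\alpha,\qquad q_3^\pm(\eta,\zeta)=\mp i(\hat\eta\times\hat\zeta)\cdot S .$$ With $\langle v,w\rangle=w^\dagger v$ on $\mathbb C^4$, define the bilinear forms $$Q_j(\psi^+,\psi^\pm)=\mathcal F_x^{-1}\left[\int_{\mathbb R^3}\big\langle\beta\widehat{\psi^+}(\eta),\,q_j^\pm(\eta,\eta-\xi)\,\widehat{\psi^\pm}(\eta-\xi)\big\rangle\,d\eta\right],\qquad j=1,2,3,$$ where the symbol $q_j^+$ is used when the second argument is $S_m(t)g$ and $q_j^-$ when it is $S_m(-t)g$. The norm $\|\cdot\|$ is that of $L^2_{t,x}(\mathbb R^{1+3})$ for functions of $(t,x)$ and that of $L^2_x(\mathbb R^3)$ for functions of $x$. Statement. Let $m\ge0$, let $\chi$ be as above and let $K>1$. There is a constant $C>0$, depending only on $m$, $\chi$ and $K$,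 such that for all dyadic numbers $\mu,\lambda_1,\lambda_2\ge1$ (of the form $2^k$, $k\in\mathbb Z$), all $j\in\{1,2,3\}$ and all $f,g\in L^2(\mathbb R^3;\mathbb C^4)$ the functions below belong to $L^2_{t,x}$ and satisfy the following bounds. Here $\mu\lesssim\lambda_1$ means $\mu\le K\lambda_1$, $\lambda_1\sim\lambda_2$ means $K^{-1}\lambda_2\le\lambda_1\le K\lambda_2$, and $\lambda_1\nsim\lambda_2$ means $\lambda_1\le K^{-1}\lambda_2$ or $\lambda_2\le K^{-1}\lambda_1$. (i) (++) interaction: $$\|P_\mu Q_j(S_m(t)f_{\lambda_1},S_m(t)g_{\lambda_2})\|\le C\begin{cases}(\lambda_1\wedge\lambda_2)\,\|f_{\lambda_1}\|\|g_{\lambda_2}\|&\text{if }\lambda_1\nsim\lambda_2,\\ \mu\,(\mu/\lambda_1)^{1/2}\,\|f_{\lambda_1}\|\|g_{\lambda_2}\|&\text{if }\mu\lesssim\lambda_1\sim\lambda_2.\end{cases}$$ (ii) (+-) interaction: $$\|P_\mu Q_j(S_m(t)f_{\lambda_1},S_m(-t)g_{\lambda_2})\|\le C\begin{cases}(\lambda_1\wedge\lambda_2)\,\|f_{\lambda_1}\|\|g_{\lambda_2}\|&\text{if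 }\lambda_1\nsim\lambda_2,\\ \mu\,\|f_{\lambda_1}\|\|g_{\lambda_2}\|&\text{if }\mu\lesssim\lambda_1\sim\lambda_2.\end{cases}$$ -/

import Mathlib

open MeasureTheory
open scoped ContDiff FourierTransform Matrix

noncomputable section

namespace DiracNull

/-- Physical (and frequency) space `ℝ³` with the Euclidean norm. -/
abbrev E3 : Type := EuclideanSpace ℝ (Fin 3)

/-- The spinor space `ℂ⁴`, written in `2 + 2` blocks. -/
abbrev Spinor : Type := EuclideanSpace ℂ (Fin 2 ⊕ Fin 2)

/-- `4 × 4` complex matrices, in `2 + 2` blocks. -/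
abbrev Mat4 : Type := Matrix (Fin 2 ⊕ Fin 2) (Fin 2 ⊕ Fin 2) ℂ

/-- The space `L²(ℝ³; ℂ⁴)`. -/
abbrev L2 : Type := Lp (α := E3) Spinor 2

/-! ### Dirac matrices -/

/-- The Pauli matrices `σ¹, σ², σ³`. -/
def pauli : Fin 3 → Matrix (Fin 2) (Fin 2) ℂ :=
  ![!![0, 1; 1, 0], !![0, -Complex.I; Complex.I, 0], !![1, 0; 0, -1]]

/-- `β = γ⁰`. -/
def beta : Mat4 := Matrix.fromBlocks 1 0 0 (-1)

/-- `γʲ`. -/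
def gamma (j : Fin 3) : Mat4 := Matrix.fromBlocks 0 (pauli j) (-pauli j) 0

/-- `αʲ = γ⁰ γʲ`. -/
def alpha (j : Fin 3) : Mat4 := beta * gamma j

/-- `Sˡ = diag(σˡ, σˡ)`. -/
def spin (l : Fin 3) : Mat4 := Matrix.fromBlocks (pauli l) 0 0 (pauli l)

/-- `v · M = ∑ₖ vₖ Mᵏ` for a real vector `v` and a triple `M` of matrices. -/
def vecDot (v : Fin 3 → ℝ) (M : Fin 3 → Mat4) : Mat4 := ∑ k, (v k : ℂ) • M k

/-! ### Fourier transform, Fourier multipliers -/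

/-- The (Plancherel) Fourier transform with the normalization
`f̂(ξ) = ∫ e^{-i x·ξ} f(x) dx`, obtained by rescaling Mathlib's transform. -/
def hat (f : L2) (ξ : E3) : Spinor := (𝓕 f : L2) ((2 * Real.pi)⁻¹ • ξ)

/-- The inverse Fourier transform `(2π)⁻³ ∫ e^{i x·ξ} G(ξ) dξ` of an integrable function. -/
def invFourier (G : E3 → ℂ) (x : E3) : ℂ :=
  ((2 * Real.pi : ℝ) : ℂ)⁻¹ ^ 3 *
    ∫ ξ : E3, Complex.exp (Complex.I * ((inner ℝ x ξ : ℝ) : ℂ)) * G ξ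

theorem memLp_multiplier (a : E3 → ℂ) (ha : Measurable a) (hb : ∃ C : ℝ, ∀ ξ, ‖a ξ‖ ≤ C)
    (f : L2) : MemLp (fun ξ : E3 => a ((2 * Real.pi) • ξ) • (f : E3 → Spinor) ξ) 2 volume := by
  obtain ⟨C, hC⟩ := hb
  refine MemLp.of_le_mul (c := C) (Lp.memLp f) ?_ ?_
  · exact ((ha.comp (measurable_const_smul (2 * Real.pi))).aestronglyMeasurable).smul
      (Lp.aestronglyMeasurable f)
  · refine Filter.Eventually.of_forall fun ξ => ?_
    rw [norm_smul]
    exact mul_le_mul_of_nonneg_right (hC _) (norm_nonneg _)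

/-- The Fourier multiplier on `L²(ℝ³; ℂ⁴)` with bounded measurable symbol `a`:
the transform of `a(D) f` is `a(ξ) f̂(ξ)` in the normalization of `hat`. -/
def fourierMultiplier (a : E3 → ℂ) (ha : Measurable a) (hb : ∃ C : ℝ, ∀ ξ, ‖a ξ‖ ≤ C)
    (f : L2) : L2 :=
  𝓕⁻ ((memLp_multiplier a ha hb (𝓕 f : L2)).toLp _)

/-! ### Frequency projections -/

/-- An even cutoff `χ ∈ C₀^∞((-2, 2))` with `χ = 1` on `[-1, 1]`. -/
structure Cutoff where
  toFun : ℝ → ℝ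
  contDiff : ContDiff ℝ ∞ toFun
  even : ∀ s, toFun (-s) = toFun s
  tsupport_subset : tsupport toFun ⊆ Set.Ioo (-2) 2
  eq_one : ∀ s, |s| ≤ 1 → toFun s = 1

/-- The dyadic cutoffs `ρ_l`. -/
def rho (χ : Cutoff) (l s : ℝ) : ℝ :=
  if l < 1 then 0
  else if l = 1 then χ.toFun s
  else χ.toFun (s / l) - χ.toFun (2 * s / l)

theorem Cutoff.bounded (χ : Cutoff) : ∃ C : ℝ, ∀ s, ‖χ.toFun s‖ ≤ C := by
  have hc : HasCompactSupport χ.toFun :=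
    isCompact_Icc.of_isClosed_subset (isClosed_tsupport _)
      (χ.tsupport_subset.trans (Set.Ioo_subset_Icc_self (a := (-2 : ℝ)) (b := 2)))
  exact hc.exists_bound_of_continuous χ.contDiff.continuous

theorem measurable_rho_norm (χ : Cutoff) (l : ℝ) :
    Measurable fun ξ : E3 => ((rho χ l ‖ξ‖ : ℝ) : ℂ) := by
  have hχ : Measurable χ.toFun := χ.contDiff.continuous.measurable
  have h : Measurable (rho χ l) := by
    unfold rho
    split_ifs
    · exact measurable_const
    · exact hχ
    · exact (hχ.comp (measurable_id.div_const l)).sub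
        (hχ.comp ((measurable_id.const_mul 2).div_const l))
  exact Complex.measurable_ofReal.comp (h.comp measurable_norm)

theorem bounded_rho_norm (χ : Cutoff) (l : ℝ) :
    ∃ C : ℝ, ∀ ξ : E3, ‖((rho χ l ‖ξ‖ : ℝ) : ℂ)‖ ≤ C := by
  obtain ⟨C, hC⟩ := χ.bounded
  have h0 : 0 ≤ C := (norm_nonneg _).trans (hC 0)
  refine ⟨C + C, fun ξ => ?_⟩
  rw [Complex.norm_real]
  unfold rho
  split_ifs
  · simpa using add_nonneg h0 h0
  · exact (hC _).trans (by linarith)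
  · exact (norm_sub_le _ _).trans (add_le_add (hC _) (hC _))

/-- The frequency projection `P_l f = F⁻¹[ρ_l(|ξ|) f̂(ξ)]` on `L²(ℝ³; ℂ⁴)`. -/
def freqProj (χ : Cutoff) (l : ℝ) (f : L2) : L2 :=
  fourierMultiplier _ (measurable_rho_norm χ l) (bounded_rho_norm χ l) f

/-! ### Free waves -/

/-- `⟨ξ⟩_m = √(m² + |ξ|²)`. -/
def bracket (m : ℝ) (ξ : E3) : ℝ := Real.sqrt (m ^ 2 + ‖ξ‖ ^ 2)

/-- The symbol `e^{-i t ⟨ξ⟩_m}`. -/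
def propagatorSymbol (m t : ℝ) (ξ : E3) : ℂ :=
  Complex.exp (-Complex.I * ((t * bracket m ξ : ℝ) : ℂ))

theorem measurable_propagatorSymbol (m t : ℝ) : Measurable (propagatorSymbol m t) := by
  unfold propagatorSymbol bracket
  fun_prop

theorem bounded_propagatorSymbol (m t : ℝ) : ∃ C : ℝ, ∀ ξ, ‖propagatorSymbol m t ξ‖ ≤ C :=
  ⟨1, fun ξ => by simp [propagatorSymbol, Complex.norm_exp]⟩

/-- The propagator `S_m(t) = e^{-i t ⟨D⟩_m}`, `t ∈ ℝ`; so `S_m(-t) = e^{+i t ⟨D⟩_m}`. -/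
def propagator (m t : ℝ) (f : L2) : L2 :=
  fourierMultiplier _ (measurable_propagatorSymbol m t) (bounded_propagatorSymbol m t) f

/-! ### Null forms -/

/-- The normalized frequency `ξ / ⟨ξ⟩_m`. -/
def unitFreq (m : ℝ) (ξ : E3) : E3 := (bracket m ξ)⁻¹ • ξ

/-- The null symbols `q₁^ε, q₂^ε, q₃^ε` (indexed by `j = 0, 1, 2`); the sign `ε` is `1` or `-1`.
With `a = η/⟨η⟩_m` and `b = ζ/⟨ζ⟩_m` they are
`(|a||b| - ε a·b) I`, `-(|b| a - ε |a| b)·α` and `-ε i (a × b)·S`. -/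
def nullSymbol (m ε : ℝ) (j : Fin 3) (η ζ : E3) : Mat4 :=
  let a := unitFreq m η
  let b := unitFreq m ζ
  ![((‖a‖ * ‖b‖ - ε * inner ℝ a b : ℝ) : ℂ) • (1 : Mat4),
    -vecDot (fun k => a k * ‖b‖ - ε * (b k * ‖a‖)) alpha,
    (-(ε : ℂ) * Complex.I) • vecDot (crossProduct (fun k => a k) (fun k => b k)) spin] j

/-- The inner product of `ℂ⁴`, linear in the first and antilinear in the second argument:
`⟨v, w⟩ = w† v`. -/
def spinorInner (v w : Fin 2 ⊕ Fin 2 → ℂ) : ℂ := v ⬝ᵥ star w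

/-- The spatial Fourier transform of the null form `Q_j(ψ, φ)` (with symbol `q_j^ε`):
`∬_{ξ = η - ζ} ⟨β ψ̂(η), q_j^ε(η, ζ) φ̂(ζ)⟩ dη dζ`, that is, the integral over `η` with
`ζ = η - ξ`. For `ψ, φ ∈ L²` it converges absolutely for every `ξ` and is bounded in `ξ`. -/
def nullFormHat (m ε : ℝ) (j : Fin 3) (ψ φ : L2) (ξ : E3) : ℂ :=
  ∫ η : E3, spinorInner (beta *ᵥ (hat ψ η).ofLp)
    (nullSymbol m ε j η (η - ξ) *ᵥ (hat φ (η - ξ)).ofLp)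

/-- `P_μ Q_j(ψ, φ) = F⁻¹[ρ_μ(|ξ|) F[Q_j(ψ, φ)](ξ)]`; for `ψ, φ ∈ L²` the function in the
bracket is bounded with compact support, so that `F⁻¹` is an absolutely convergent integral. -/
def projNullForm (χ : Cutoff) (m ε μ : ℝ) (j : Fin 3) (ψ φ : L2) : E3 → ℂ :=
  invFourier fun ξ => ((rho χ μ ‖ξ‖ : ℝ) : ℂ) * nullFormHat m ε j ψ φ ξ

/-- The space-time function `P_μ Q_j(S_m(t) f, S_m(ε t) g)` of `(t, x) ∈ ℝ × ℝ³`: the (++)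
interaction for `ε = 1`, the (+-) interaction for `ε = -1`. -/
def waveNullForm (χ : Cutoff) (m ε μ : ℝ) (j : Fin 3) (f g : L2) (p : ℝ × E3) : ℂ :=
  projNullForm χ m ε μ j (propagator m p.1 f) (propagator m (ε * p.1) g) p.2

/-- `u ∈ L²_{t,x}(ℝ^{1+3})` with `‖u‖ ≤ B`. -/
def L2Bound (u : ℝ × E3 → ℂ) (B : ℝ) : Prop :=
  MemLp u 2 volume ∧ eLpNorm u 2 volume ≤ ENNReal.ofReal B

/-- Dyadic numbers `2^k`, `k ∈ ℤ`. -/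
def IsDyadic (l : ℝ) : Prop := ∃ k : ℤ, l = (2 : ℝ) ^ k

/-- `A ≲ B` with implicit constant `K`. -/
def Lesssim (K A B : ℝ) : Prop := A ≤ K * B

/-- `A ∼ B` with implicit constant `K`. -/
def Comparable (K A B : ℝ) : Prop := Lesssim K A B ∧ Lesssim K B A

/-- `A ≁ B` with implicit constant `K`: `A ≤ K⁻¹ B` or `B ≤ K⁻¹ A`. -/
def NotComparable (K A B : ℝ) : Prop := A ≤ K⁻¹ * B ∨ B ≤ K⁻¹ * A

end DiracNull

end

noncomputable section

namespace DiracNull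

/-! By Plancherel in `x`, matters reduce to the oscillatory integrals `∫ e^{-itφ} h(ξ, η) dη` with
phase `φ(η) = ⟨η⟩_m - ε⟨η - ξ⟩_m`, to be bounded in `L²` of `(t, ξ)`. For fixed `ξ`, Plancherel in
`t` and Cauchy–Schwarz on the level sets of `φ` would cost a factor `1/|∇φ|`; the null symbol pays
for it.

With `a = η/⟨η⟩_m`, `b = (η - ξ)/⟨η - ξ⟩_m` and `θ = |a||b| - ε a·b`, each symbol satisfies `|q_j|²
≲ θ`, while `∇φ = a - εb` gives `2θ ≤ |∇φ|²`. Hence, if `θ ≤ δ²` on the support, `|q_j|² ≲ √θ √θ ≤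
δ|∇φ|`. On a cube of side `R` the measure `|∇φ| dη` is pushed forward by `φ` to a measure of density
`O(R²)`: along a coordinate line `φ` takes each value at most twice off its critical points, and the
cross-section has area `R²`. No level-set geometry is needed. The squared bound is therefore of size
`δR²` (`Dominated.lintegral_oscillatory_sq_le`).

The cases differ only in `δ` and `R`. One input always lies in a cube of side `4 min(λ₁, λ₂)`, which
with `δ = 2` gives the bound by the minimum. For output frequency `μ`, cutting the inputs into cells
of side `μ` gives `R = μ` by almost orthogonality
(`Dominated.lintegral_oscillatory_sq_le_of_output`); `δ = 2` yields the factor `μ`. For (++), `θ ≤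
|ξ|²/(2⟨η⟩_m⟨η - ξ⟩_m)` allows `δ` of order `μ/λ₁` (`angular_one_le_of_shell`), whence the extra
`(μ/λ₁)^{1/2}`. -/

theorem eLpNorm_two_sq {α F : Type*} [MeasurableSpace α] [NormedAddCommGroup F] (f : α → F)
    (ν : Measure α) : eLpNorm f 2 ν ^ 2 = ∫⁻ x, ‖f x‖ₑ ^ 2 ∂ν := by
  simpa using eLpNorm_nnreal_pow_eq_lintegral (p := 2) (f := f) (μ := ν) two_ne_zero

/-! ### Plancherel's theorem for Fourier integrals -/

section Plancherel

variable {V : Type*} [NormedAddCommGroup V] [InnerProductSpace ℝ V] [FiniteDimensional ℝ V]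
  [MeasurableSpace V] [BorelSpace V]

/-- The `L²` Fourier transform of an integrable function is given by the Fourier integral. -/
theorem fourier_toLp_ae_eq {a : V → ℂ} (h1 : Integrable a) (h2 : MemLp a 2 volume) :
    ((𝓕 (h2.toLp a) : Lp (α := V) ℂ 2 volume) : V → ℂ) =ᵐ[volume] 𝓕 a := by
  have hcont : Continuous (𝓕 a) :=
    VectorFourier.fourierIntegral_continuous Real.continuous_fourierChar
      (by exact continuous_inner) h1
  refine ae_eq_of_integral_contDiff_smul_eq
    ((Lp.memLp _).locallyIntegrable (by norm_num)) hcont.locallyIntegrable ?_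
  intro g hg hgc
  have hg₁ : HasCompactSupport (Complex.ofRealCLM ∘ g) := hgc.comp_left rfl
  have hg₂ : ContDiff ℝ ∞ (Complex.ofRealCLM ∘ g) := by fun_prop
  set G : SchwartzMap V ℂ := hg₁.toSchwartzMap hg₂ with hG
  have hGg : ∀ x, G x = (g x : ℂ) := fun x => by simp [hG]
  -- The `L²` transform agrees with the distributional one, so testing against a Schwartz function
  -- moves the transform onto it; Fubini moves it back onto the integrable `a`.
  have key := DFunLike.congr_fun (Lp.fourier_toTemperedDistribution_eq (h2.toLp a)) G
  rw [TemperedDistribution.fourier_apply, Lp.toTemperedDistribution_apply,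
    Lp.toTemperedDistribution_apply] at key
  have e1 : ∫ x, g x • (𝓕 (h2.toLp a) : Lp (α := V) ℂ 2 volume) x
      = ∫ x, G x • (𝓕 (h2.toLp a) : Lp (α := V) ℂ 2 volume) x := by
    simp [hGg]
  have e2 : ∫ x, g x • 𝓕 a x = ∫ x, G x • 𝓕 a x := by
    simp [hGg]
  have e3 : ∫ x, (𝓕 G) x • h2.toLp a x = ∫ x, (𝓕 G) x • a x :=
    integral_congr_ae (by filter_upwards [h2.coeFn_toLp] with x hx; rw [hx])
  have e4 : ∫ x, (𝓕 (G : V → ℂ)) x • a x = ∫ x, G x • 𝓕 a x := by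
    simpa using! (VectorFourier.integral_fourierIntegral_smul_eq_flip (L := innerₗ V)
      Real.continuous_fourierChar continuous_inner G.integrable h1)
  rw [e1, e2, ← key, e3, ← e4, SchwartzMap.fourier_coe]

/-- Plancherel's theorem on `L¹ ∩ L²`. -/
theorem lintegral_enorm_fourier_sq {a : V → ℂ} (h1 : Integrable a) (h2 : MemLp a 2 volume) :
    ∫⁻ ξ, ‖𝓕 a ξ‖ₑ ^ 2 = ∫⁻ x, ‖a x‖ₑ ^ 2 := by
  have h : eLpNorm (𝓕 a) 2 volume = eLpNorm a 2 volume := by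
    rw [← eLpNorm_congr_ae (fourier_toLp_ae_eq h1 h2), ← eLpNorm_congr_ae h2.coeFn_toLp,
      ← Lp.enorm_def, ← Lp.enorm_def, ← ofReal_norm, ← ofReal_norm, Lp.norm_fourier_eq]
  rw [← eLpNorm_two_sq, ← eLpNorm_two_sq, h]

theorem lintegral_comp_smul_volume {r : ℝ} (hr : 0 < r) (f : V → ENNReal) :
    ∫⁻ x, f (r⁻¹ • x) = ENNReal.ofReal (r ^ Module.finrank ℝ V) * ∫⁻ x, f x := by
  have hm : MeasurableEmbedding fun x : V => r⁻¹ • x :=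
    (Homeomorph.smulOfNeZero r⁻¹ (inv_ne_zero hr.ne')).measurableEmbedding
  rw [← hm.lintegral_map, Measure.map_addHaar_smul _ (inv_ne_zero hr.ne'), lintegral_smul_measure]
  congr 2
  rw [inv_pow, inv_inv, abs_of_pos (by positivity)]

/-- The kernel without `2π` is the transform `𝓕` at `ξ/2π`; the dilation produces the factor
`(2π)^dim`. -/
theorem lintegral_enorm_integral_exp_neg_sq {a : V → ℂ} (h1 : Integrable a)
    (h2 : MemLp a 2 volume) :
    ∫⁻ ξ, ‖∫ x, Complex.exp (-Complex.I * ((inner ℝ ξ x : ℝ) : ℂ)) * a x‖ₑ ^ 2 =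
      ENNReal.ofReal ((2 * Real.pi) ^ Module.finrank ℝ V) * ∫⁻ x, ‖a x‖ₑ ^ 2 := by
  rw [← lintegral_enorm_fourier_sq h1 h2, ← lintegral_comp_smul_volume Real.two_pi_pos]
  refine lintegral_congr fun ξ => ?_
  congr 2
  rw [Real.fourier_eq']
  refine integral_congr_ae (Filter.Eventually.of_forall fun x => ?_)
  simp only [smul_eq_mul]
  congr 2
  rw [inner_smul_right, real_inner_comm]
  push_cast
  have : (Real.pi : ℂ) ≠ 0 := by exact_mod_cast Real.pi_ne_zero
  field_simp

theorem lintegral_enorm_integral_exp_sq {a : V → ℂ} (h1 : Integrable a)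
    (h2 : MemLp a 2 volume) :
    ∫⁻ ξ, ‖∫ x, Complex.exp (Complex.I * ((inner ℝ ξ x : ℝ) : ℂ)) * a x‖ₑ ^ 2 =
      ENNReal.ofReal ((2 * Real.pi) ^ Module.finrank ℝ V) * ∫⁻ x, ‖a x‖ₑ ^ 2 := by
  rw [← lintegral_enorm_integral_exp_neg_sq h1 h2, ← lintegral_neg_eq_self]
  simp

end Plancherel

/-! ### Oscillatory integrals in time and the dual coarea argument -/

section Oscillatory

variable {X : Type*} [MeasurableSpace X] {ν : Measure X}

theorem memLp_two_of_integrable_of_bound {a : X → ℂ} (ha : Integrable a ν) {B : ℝ}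
    (hB : ∀ x, ‖a x‖ ≤ B) : MemLp a 2 ν := by
  rw [memLp_two_iff_integrable_sq_norm ha.1]
  simp only [sq]
  exact ha.norm.bdd_mul ha.norm.1 (Filter.Eventually.of_forall fun x => by simpa using hB x)

/-- Cauchy–Schwarz, phrased so that no square roots of `u` and `v` have to be chosen by the user. -/
theorem lintegral_sq_le_of_sq_le_mul {h u v : X → ENNReal} (hu : AEMeasurable u ν)
    (hv : AEMeasurable v ν) (hh : ∀ x, h x ^ 2 ≤ u x * v x) :
    (∫⁻ x, h x ∂ν) ^ 2 ≤ (∫⁻ x, u x ∂ν) * ∫⁻ x, v x ∂ν := by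
  have hle : ∀ x, h x ≤ u x ^ (1 / 2 : ℝ) * v x ^ (1 / 2 : ℝ) := fun x => by
    rw [← ENNReal.mul_rpow_of_nonneg _ _ (by norm_num)]
    calc h x = (h x ^ 2) ^ (1 / 2 : ℝ) := by
          rw [← ENNReal.rpow_natCast, ← ENNReal.rpow_mul]; norm_num
      _ ≤ _ := ENNReal.rpow_le_rpow (hh x) (by norm_num)
  have hsq : ∀ y : ENNReal, (y ^ (1 / 2 : ℝ)) ^ (2 : ℝ) = y := fun y => by
    rw [← ENNReal.rpow_mul]; norm_num
  have hpq : (2 : ℝ).HolderConjugate 2 := by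
    rw [Real.holderConjugate_iff]; norm_num
  have key := ENNReal.lintegral_mul_le_Lp_mul_Lq ν hpq (hu.pow_const (1 / 2 : ℝ))
    (hv.pow_const (1 / 2 : ℝ))
  simp only [hsq, Pi.mul_apply] at key
  calc (∫⁻ x, h x ∂ν) ^ 2
      ≤ ((∫⁻ x, u x ∂ν) ^ (1 / 2 : ℝ) * (∫⁻ x, v x ∂ν) ^ (1 / 2 : ℝ)) ^ 2 := by
        gcongr
        exact (lintegral_mono hle).trans key
    _ = _ := by
        rw [mul_pow, ← ENNReal.rpow_natCast, ← ENNReal.rpow_natCast]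
        push_cast
        rw [hsq, hsq]

/-- The hypothesis says that the push-forward of `w ν` under `φ` is at most `M` times Lebesgue
measure; change of variables does the rest. This replaces integration over level sets. -/
theorem lintegral_mul_comp_le_of_pushforward_le {φ : X → ℝ} (hφ : Measurable φ)
    {w : X → ENNReal} (hw : Measurable w) {M : ENNReal}
    (hpush : ∀ S : Set ℝ, MeasurableSet S → ∫⁻ x in φ ⁻¹' S, w x ∂ν ≤ M * volume S)
    {p : ℝ → ENNReal} (hp : Measurable p) :
    ∫⁻ x, w x * p (φ x) ∂ν ≤ M * ∫⁻ τ, p τ := by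
  have hle : (ν.withDensity w).map φ ≤ M • (volume : Measure ℝ) := by
    refine Measure.le_iff.2 fun S hS => ?_
    rw [Measure.map_apply hφ hS, withDensity_apply _ (hφ hS)]
    simpa using hpush S hS
  calc ∫⁻ x, w x * p (φ x) ∂ν = ∫⁻ x, p (φ x) ∂(ν.withDensity w) := by
        exact (lintegral_withDensity_eq_lintegral_mul _ hw (hp.comp hφ)).symm
    _ = ∫⁻ τ, p τ ∂((ν.withDensity w).map φ) := (lintegral_map hp hφ).symm
    _ ≤ ∫⁻ τ, p τ ∂(M • (volume : Measure ℝ)) := lintegral_mono' hle le_rfl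
    _ = _ := by rw [lintegral_smul_measure, smul_eq_mul]

theorem norm_exp_neg_I_mul_ofReal (r : ℝ) : ‖Complex.exp (-Complex.I * (r : ℂ))‖ = 1 := by
  rw [Complex.norm_exp]; simp

theorem continuous_oscillatory_integral {φ : X → ℝ} (hφ : Measurable φ) {H : X → ℂ}
    (hH : Integrable H ν) :
    Continuous fun t : ℝ => ∫ x, Complex.exp (-Complex.I * ((t * φ x : ℝ) : ℂ)) * H x ∂ν := by
  refine continuous_of_dominated (bound := fun x => ‖H x‖) (fun t => ?_) (fun t => ?_) hH.norm ?_
  · exact (Measurable.aestronglyMeasurable (by fun_prop)).mul hH.1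
  · refine Filter.Eventually.of_forall fun x => ?_
    rw [norm_mul, norm_exp_neg_I_mul_ofReal, one_mul]
  · exact Filter.Eventually.of_forall fun x => by fun_prop

/-- A dual form of the coarea argument: if the push-forward of `w` under the phase `φ` has density
at most `M`, then oscillatory integrals with phase `t φ` and amplitude `√(w K)` are bounded in
`L²_t`. -/
theorem lintegral_enorm_oscillatory_sq_le [SigmaFinite ν] {φ : X → ℝ} (hφ : Measurable φ)
    {w : X → ENNReal} (hw : Measurable w) {M : ENNReal}
    (hpush : ∀ S : Set ℝ, MeasurableSet S → ∫⁻ x in φ ⁻¹' S, w x ∂ν ≤ M * volume S)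
    {H : X → ℂ} (hH : Integrable H ν) {k : X → ENNReal} (hk : AEMeasurable k ν)
    (hHk : ∀ x, ‖H x‖ₑ ^ 2 ≤ w x * k x) :
    ∫⁻ t : ℝ, ‖∫ x, Complex.exp (-Complex.I * ((t * φ x : ℝ) : ℂ)) * H x ∂ν‖ₑ ^ 2
      ≤ ENNReal.ofReal (2 * Real.pi) * M * ∫⁻ x, k x ∂ν := by
  set V : ℝ → ℂ := fun t => ∫ x, Complex.exp (-Complex.I * ((t * φ x : ℝ) : ℂ)) * H x ∂ν with hV
  have hVc : Continuous V := continuous_oscillatory_integral hφ hH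
  -- Truncation in time: `V` is continuous but not yet known to be in `L²`, and the argument divides
  -- by its `L²` mass, which must be finite.
  have hfin : ∀ n : ℕ, ∫⁻ t in Set.Icc (-(n : ℝ)) n, ‖V t‖ₑ ^ 2
      ≤ ENNReal.ofReal (2 * Real.pi) * M * ∫⁻ x, k x ∂ν := by
    intro n
    set I : Set ℝ := Set.Icc (-(n : ℝ)) n with hI
    have hIm : MeasurableSet I := measurableSet_Icc
    -- Duality: `V` is tested against its own truncated conjugate, so that `∫ a V = A`. After Fubini
    -- the pairing involves only the transform `b` of `a`, evaluated at the phase.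
    set a : ℝ → ℂ := I.indicator fun t => star (V t) with ha
    have haM : Measurable a := (continuous_star.comp hVc).measurable.indicator hIm
    obtain ⟨B, hB⟩ := isCompact_Icc.exists_bound_of_continuousOn (s := I) hVc.continuousOn
    have hB0 : 0 ≤ B := (norm_nonneg _).trans (hB 0 (by simp [hI]))
    have hab : ∀ t, ‖a t‖ ≤ B := fun t => by
      by_cases ht : t ∈ I
      · simpa [ha, ht] using hB t ht
      · simpa [ha, ht] using hB0
    have ha1 : Integrable a := by
      refine (integrable_indicator_iff hIm).2 ?_
      exact ((continuous_star.comp hVc).continuousOn).integrableOn_compact isCompact_Icc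
    have ha2 : MemLp a 2 volume :=
      memLp_two_of_integrable_of_bound ha1 hab
    set A : ENNReal := ∫⁻ t, ‖a t‖ₑ ^ 2 with hA
    have hAI : ∫⁻ t in I, ‖V t‖ₑ ^ 2 = A := by
      rw [hA, ← lintegral_indicator hIm]
      refine lintegral_congr fun t => ?_
      by_cases ht : t ∈ I <;> simp [ha, ht]
    set b : ℝ → ℂ := fun τ => ∫ t, Complex.exp (-Complex.I * ((inner ℝ τ t : ℝ) : ℂ)) * a t with hb
    have hbc : Continuous b := by
      have := continuous_oscillatory_integral (φ := fun t : ℝ => t) measurable_id ha1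
      simpa [hb, mul_comm] using this
    have hbA : ∫⁻ τ, ‖b τ‖ₑ ^ 2 = ENNReal.ofReal (2 * Real.pi) * A := by
      have h := lintegral_enorm_integral_exp_neg_sq ha1 ha2
      rwa [Module.finrank_self, pow_one] at h
    have hswap : ∫ t, a t * V t = ∫ x, H x * b (φ x) ∂ν := by
      have e1 : ∀ t, a t * V t
          = ∫ x, a t * (Complex.exp (-Complex.I * ((t * φ x : ℝ) : ℂ)) * H x) ∂ν := fun t => by
        rw [hV, integral_const_mul]
      have e2 : ∀ x, H x * b (φ x)
          = ∫ t, a t * (Complex.exp (-Complex.I * ((t * φ x : ℝ) : ℂ)) * H x) := fun x => by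
        rw [hb, ← integral_const_mul]
        refine integral_congr_ae (Filter.Eventually.of_forall fun t => ?_)
        simp only [RCLike.inner_apply, conj_trivial]
        ring
      simp only [e1, e2]
      refine integral_integral_swap ?_
      have hp : Integrable (fun z : ℝ × X => a z.1 * H z.2) (volume.prod ν) := ha1.mul_prod hH
      refine (hp.bdd_mul (c := 1)
        (f := fun z : ℝ × X => Complex.exp (-Complex.I * ((z.1 * φ z.2 : ℝ) : ℂ)))
        (Measurable.aestronglyMeasurable (by fun_prop)) ?_).congr ?_
      · exact Filter.Eventually.of_forall fun z => (norm_exp_neg_I_mul_ofReal _).le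
      · refine Filter.Eventually.of_forall fun z => ?_
        simp only [Function.uncurry]
        ring
    have hAeq : A = ‖∫ t, a t * V t‖ₑ := by
      have e1 : ∀ t, a t * V t = ((‖a t‖ ^ 2 : ℝ) : ℂ) := fun t => by
        by_cases ht : t ∈ I
        · simp only [ha, ht, Set.indicator_of_mem, RCLike.star_def]
          rw [mul_comm, Complex.mul_conj, Complex.normSq_eq_norm_sq, RCLike.norm_conj]
        · simp [ha, ht]
      simp only [e1]
      rw [integral_complex_ofReal]
      have h0 : 0 ≤ ∫ t, ‖a t‖ ^ 2 := integral_nonneg fun t => by positivity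
      rw [← ofReal_norm, Complex.norm_real, Real.norm_of_nonneg h0,
        ofReal_integral_eq_lintegral_ofReal ((memLp_two_iff_integrable_sq_norm ha1.1).1 ha2)
          (Filter.Eventually.of_forall fun t => by positivity)]
      refine lintegral_congr fun t => ?_
      rw [ENNReal.ofReal_pow (norm_nonneg _), ofReal_norm]
    have hAle : A ^ 2 ≤ (M * (ENNReal.ofReal (2 * Real.pi) * A)) * ∫⁻ x, k x ∂ν := by
      have hbm : Measurable fun τ => ‖b τ‖ₑ ^ 2 := hbc.measurable.enorm.pow_const 2
      calc A ^ 2 ≤ (∫⁻ x, ‖H x * b (φ x)‖ₑ ∂ν) ^ 2 := by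
            rw [hAeq, hswap]
            gcongr
            exact enorm_integral_le_lintegral_enorm _
        _ ≤ (∫⁻ x, w x * ‖b (φ x)‖ₑ ^ 2 ∂ν) * ∫⁻ x, k x ∂ν := by
            refine lintegral_sq_le_of_sq_le_mul ?_ hk fun x => ?_
            · exact (hw.mul (hbm.comp hφ)).aemeasurable
            · rw [enorm_mul, mul_pow]
              calc ‖H x‖ₑ ^ 2 * ‖b (φ x)‖ₑ ^ 2 ≤ w x * k x * ‖b (φ x)‖ₑ ^ 2 := by
                    gcongr; exact hHk x
                _ = _ := by ring
        _ ≤ _ := by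
            gcongr
            rw [← hbA]
            exact lintegral_mul_comp_le_of_pushforward_le hφ hw hpush hbm
    have hAtop : A ≠ ⊤ := by
      rw [hA, ← eLpNorm_two_sq]
      exact ENNReal.pow_ne_top ha2.2.ne
    rw [hAI]
    rcases eq_or_ne A 0 with h0 | h0
    · rw [h0]; exact zero_le
    -- The inequality `A² ≤ 2π M A ∫ k` is divided by `A`, which is finite and nonzero.
    · refine (ENNReal.mul_le_mul_iff_left h0 hAtop).1 ?_
      rw [← sq]
      exact hAle.trans (le_of_eq (by ring))
  have hmono : ∫⁻ t, ‖V t‖ₑ ^ 2 = ⨆ n : ℕ, ∫⁻ t in Set.Icc (-(n : ℝ)) n, ‖V t‖ₑ ^ 2 := by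
    rw [← setLIntegral_iUnion_of_directed]
    · have : (⋃ n : ℕ, Set.Icc (-(n : ℝ)) n) = Set.univ := by
        refine Set.eq_univ_of_forall fun t => ?_
        obtain ⟨n, hn⟩ := exists_nat_ge |t|
        exact Set.mem_iUnion.2 ⟨n, abs_le.1 hn⟩
      rw [this, setLIntegral_univ]
    · refine Monotone.directed_le fun i j hij => ?_
      have : (i : ℝ) ≤ j := by exact_mod_cast hij
      exact Set.Icc_subset_Icc (by linarith) this
  rw [hmono]
  exact iSup_le hfin

end Oscillatory

/-! ### The phase along a line -/

theorem strictMono_div_sqrt_one_add_sq : StrictMono fun x : ℝ => x / √(1 + x ^ 2) := by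
  intro x y hxy
  simp only [← Real.sin_arctan]
  exact Real.strictMonoOn_sin ⟨(Real.neg_pi_div_two_lt_arctan x).le, (Real.arctan_lt_pi_div_two x).le⟩
    ⟨(Real.neg_pi_div_two_lt_arctan y).le, (Real.arctan_lt_pi_div_two y).le⟩
    (Real.arctan_strictMono hxy)

theorem div_sqrt_add_sq_eq {A : ℝ} (hA : 0 < A) (t : ℝ) :
    t / √(A + t ^ 2) = (t / √A) / √(1 + (t / √A) ^ 2) := by
  have hs : 0 < √A := Real.sqrt_pos.2 hA
  have : √(A + t ^ 2) = √A * √(1 + (t / √A) ^ 2) := by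
    rw [← Real.sqrt_mul hA.le]
    congr 1
    rw [div_pow, Real.sq_sqrt hA.le]
    field_simp
  rw [this, div_div]

theorem hasDerivAt_sqrt_add_sq {A : ℝ} (hA : 0 < A) (c t : ℝ) :
    HasDerivAt (fun t => √(A + (t - c) ^ 2)) ((t - c) / √(A + (t - c) ^ 2)) t := by
  have h1 : HasDerivAt (fun t : ℝ => A + (t - c) ^ 2) (2 * (t - c)) t := by
    have := ((hasDerivAt_id t).sub_const c).pow 2
    simpa using this.const_add A
  have := h1.sqrt (by positivity)
  convert this using 1
  field_simp

/-- Change of variables: for injective `f` the integral is the measure of an image contained in `S`.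
-/
theorem setLIntegral_abs_deriv_le_of_injOn {f f' : ℝ → ℝ} (hf : ∀ t, HasDerivAt f (f' t) t)
    {P : Set ℝ} (hP : MeasurableSet P) (hinj : Set.InjOn f P) {S : Set ℝ} (hS : MeasurableSet S) :
    ∫⁻ t in P ∩ f ⁻¹' S, ENNReal.ofReal |f' t| ≤ volume S := by
  have hfm : Measurable f :=
    (continuous_iff_continuousAt.2 fun t => (hf t).continuousAt).measurable
  have := lintegral_image_eq_lintegral_abs_deriv_mul (hP.inter (hfm hS))
    (fun t _ => (hf t).hasDerivWithinAt) (hinj.mono Set.inter_subset_left) fun _ => 1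
  simp only [mul_one, setLIntegral_const, one_mul] at this
  rw [← this]
  exact measure_mono (by rintro _ ⟨t, ht, rfl⟩; exact ht.2)

/-- The derivative of `√(A + t²) - ε √(B + (t - c)²)` has the sign of an affine function of `t`,
so that this function takes each value at most twice where its derivative does not vanish. -/
theorem setLIntegral_abs_deriv_phase_le {A B : ℝ} (hA : 0 < A) (hB : 0 < B) (c : ℝ) {ε : ℝ}
    (hε : ε = 1 ∨ ε = -1) {S : Set ℝ} (hS : MeasurableSet S) :
    ∫⁻ t in (fun t => √(A + t ^ 2) - ε * √(B + (t - c) ^ 2)) ⁻¹' S,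
      ENNReal.ofReal |t / √(A + t ^ 2) - ε * ((t - c) / √(B + (t - c) ^ 2))| ≤ 2 * volume S := by
  set f : ℝ → ℝ := fun t => √(A + t ^ 2) - ε * √(B + (t - c) ^ 2) with hf
  set f' : ℝ → ℝ := fun t => t / √(A + t ^ 2) - ε * ((t - c) / √(B + (t - c) ^ 2)) with hf'
  have hd : ∀ t, HasDerivAt f (f' t) t := fun t => by
    have h1 := hasDerivAt_sqrt_add_sq hA 0 t
    simp only [sub_zero] at h1
    exact h1.sub ((hasDerivAt_sqrt_add_sq hB c t).const_mul ε)
  have hfc : Continuous f := continuous_iff_continuousAt.2 fun t => (hd t).continuousAt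
  set g : ℝ → ℝ := fun x => x / √(1 + x ^ 2) with hg
  -- Since `g` is odd, the sign `ε` may be moved inside its argument. As `g` is strictly increasing,
  -- `f' = g ∘ u - g ∘ v` has the sign of the affine function `u - v`.
  set u : ℝ → ℝ := fun t => t / √A with hu
  set v : ℝ → ℝ := fun t => ε * ((t - c) / √B) with hv
  have hfg : ∀ t, f' t = g (u t) - g (v t) := fun t => by
    simp only [hf', hg, hu, hv]
    rw [div_sqrt_add_sq_eq hA, div_sqrt_add_sq_eq hB]
    rcases hε with rfl | rfl
    · simp
    · simp [neg_div]
  have hgm : StrictMono g := strictMono_div_sqrt_one_add_sq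
  have hconv : ∀ s : ℝ, Convex ℝ {t | 0 < s * (u t - v t)} := fun s => by
    intro x hx y hy a b ha hb hab
    simp only [Set.mem_ofPred_eq] at hx hy ⊢
    have : s * (u (a • x + b • y) - v (a • x + b • y))
        = a * (s * (u x - v x)) + b * (s * (u y - v y)) := by
      simp only [hu, hv, smul_eq_mul]
      obtain rfl : b = 1 - a := by linarith
      ring
    rw [this]
    rcases ha.eq_or_lt with rfl | ha'
    · obtain rfl : b = 1 := by linarith
      simpa using hy
    · have := mul_pos ha' hx
      have := mul_nonneg hb hy.le
      linarith
  have huc : Continuous u := by fun_prop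
  have hvc : Continuous v := by fun_prop
  have hopen : ∀ s : ℝ, IsOpen {t | 0 < s * (u t - v t)} := fun s =>
    isOpen_lt continuous_const (by fun_prop)
  have hinj1 : Set.InjOn f {t | 0 < (1 : ℝ) * (u t - v t)} := by
    refine (strictMonoOn_of_deriv_pos (hconv 1) hfc.continuousOn fun t ht => ?_).injOn
    have ht := interior_subset ht
    rw [(hd t).deriv, hfg]
    have : v t < u t := by simpa using ht
    exact sub_pos.2 (hgm this)
  have hinj2 : Set.InjOn f {t | 0 < (-1 : ℝ) * (u t - v t)} := by
    refine (strictAntiOn_of_deriv_neg (hconv (-1)) hfc.continuousOn fun t ht => ?_).injOn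
    have ht := interior_subset ht
    rw [(hd t).deriv, hfg]
    have : u t < v t := by simpa using ht
    exact sub_neg.2 (hgm this)
  have h1 := setLIntegral_abs_deriv_le_of_injOn hd (hopen 1).measurableSet hinj1 hS
  have h2 := setLIntegral_abs_deriv_le_of_injOn hd (hopen (-1)).measurableSet hinj2 hS
  -- The critical set may be the whole line, if `u` and `v` coincide, but the integrand vanishes
  -- there.
  have hZ : ∫⁻ t in {t | u t = v t} ∩ f ⁻¹' S, ENNReal.ofReal |f' t| = 0 := by
    refine (setLIntegral_congr_fun (g := fun _ => 0)
      ((measurableSet_eq_fun huc.measurable hvc.measurable).inter (hfc.measurable hS))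
      fun t ht => ?_).trans (by simp)
    have : u t = v t := ht.1
    simp [hfg, this]
  have hsub : f ⁻¹' S ⊆ (({t | 0 < (1 : ℝ) * (u t - v t)} ∩ f ⁻¹' S) ∪
      ({t | 0 < (-1 : ℝ) * (u t - v t)} ∩ f ⁻¹' S)) ∪ ({t | u t = v t} ∩ f ⁻¹' S) := by
    intro t ht
    rcases lt_trichotomy (u t) (v t) with h | h | h
    · exact Or.inl (Or.inr ⟨by simpa using h, ht⟩)
    · exact Or.inr ⟨h, ht⟩
    · exact Or.inl (Or.inl ⟨by simpa using h, ht⟩)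
  calc _ ≤ _ := lintegral_mono_set hsub
    _ ≤ _ := lintegral_union_le _ _ _
    _ ≤ (volume S + volume S) + 0 := by
        gcongr
        · exact (lintegral_union_le _ _ _).trans (add_le_add h1 h2)
        · exact hZ.le
    _ = _ := by rw [add_zero, two_mul]

/-! ### The phase on frequency space and its push-forward on cubes -/

/-- The phase `⟨η⟩_m - ε ⟨η - ξ⟩_m`. -/
def phase (m ε : ℝ) (ξ η : E3) : ℝ := bracket m η - ε * bracket m (η - ξ)

/-- The partial derivative in `η_k` of the phase. -/
def phaseDeriv (m ε : ℝ) (k : Fin 3) (ξ η : E3) : ℝ :=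
  unitFreq m η k - ε * unitFreq m (η - ξ) k

theorem continuous_bracket (m : ℝ) : Continuous (bracket m) := by
  unfold bracket; fun_prop

theorem measurable_phase (m ε : ℝ) : Measurable fun p : E3 × E3 => phase m ε p.1 p.2 := by
  unfold phase bracket; fun_prop

theorem measurable_unitFreq (m : ℝ) : Measurable (unitFreq m) :=
  ((continuous_bracket m).measurable.inv).smul measurable_id

theorem measurable_coord (k : Fin 3) : Measurable fun x : E3 => x k := by fun_prop

theorem measurable_phaseDeriv (m ε : ℝ) (k : Fin 3) :
    Measurable fun p : E3 × E3 => phaseDeriv m ε k p.1 p.2 := by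
  unfold phaseDeriv
  exact ((measurable_coord k).comp ((measurable_unitFreq m).comp measurable_snd)).sub
    (((measurable_coord k).comp ((measurable_unitFreq m).comp
      (measurable_snd.sub measurable_fst))).const_mul ε)

/-- The cube with corner `c` and side `R`. -/
def cube (c : E3) (R : ℝ) : Set E3 := {η | ∀ k, c k ≤ η k ∧ η k ≤ c k + R}

theorem measurableSet_cube (c : E3) (R : ℝ) : MeasurableSet (cube c R) := by
  have : cube c R = ⋂ k, {η : E3 | c k ≤ η k ∧ η k ≤ c k + R} := by
    ext; simp [cube]
  rw [this]
  exact MeasurableSet.iInter fun k => (measurable_coord k) measurableSet_Icc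

theorem lintegral_eq_lintegral_insertNth (k : Fin 3) {F : E3 → ENNReal} (hF : Measurable F) :
    ∫⁻ η, F η = ∫⁻ y : Fin 2 → ℝ, ∫⁻ t : ℝ, F (WithLp.toLp 2 (k.insertNth t y)) := by
  have h1 := (EuclideanSpace.volume_preserving_symm_measurableEquiv_toLp (Fin 3)).symm
  have h2 := (volume_preserving_piFinSuccAbove (fun _ : Fin 3 => ℝ) k).symm
  have hF' : Measurable fun x : Fin 3 → ℝ => F (WithLp.toLp 2 x) :=
    hF.comp (MeasurableEquiv.toLp 2 (Fin 3 → ℝ)).measurable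
  have e2 := h2.lintegral_comp hF'
  rw [← h1.lintegral_comp hF]
  refine e2.symm.trans ?_
  rw [Measure.volume_eq_prod, lintegral_prod_symm]
  · rfl
  · exact (hF'.comp (MeasurableEquiv.measurable _)).aemeasurable

theorem sq_norm_insertNth (k : Fin 3) (t : ℝ) (y : Fin 2 → ℝ) :
    ‖(WithLp.toLp 2 (k.insertNth t y : Fin 3 → ℝ) : E3)‖ ^ 2 = t ^ 2 + ∑ j, y j ^ 2 := by
  rw [EuclideanSpace.real_norm_sq_eq, Fin.sum_univ_succAbove _ k]
  simp

theorem toLp_insertNth_sub (k : Fin 3) (t : ℝ) (y : Fin 2 → ℝ) (ξ : E3) :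
    (WithLp.toLp 2 (k.insertNth t y : Fin 3 → ℝ) : E3) - ξ
      = WithLp.toLp 2 (k.insertNth (t - ξ k) fun j => y j - ξ (k.succAbove j)) := by
  ext i
  refine Fin.succAboveCases k ?_ (fun j => ?_) i <;> simp

/-- Fubini with `η_k` innermost: on each line the one-dimensional bound `2 |S|` holds uniformly, and
the lines meeting the cube fill a cross-section of area `R²`. -/
theorem setLIntegral_abs_phaseDeriv_le (m : ℝ) {ε : ℝ} (hε : ε = 1 ∨ ε = -1) (k : Fin 3)
    (ξ c : E3) {R : ℝ} (hR : 0 ≤ R) {S : Set ℝ} (hS : MeasurableSet S) :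
    ∫⁻ η in cube c R ∩ phase m ε ξ ⁻¹' S, ENNReal.ofReal |phaseDeriv m ε k ξ η|
      ≤ 2 * ENNReal.ofReal (R ^ 2) * volume S := by
  have hφ : Measurable (phase m ε ξ) := Measurable.of_uncurry_left (f := phase m ε) (measurable_phase m ε)
  have hφ' : Measurable (phaseDeriv m ε k ξ) :=
    Measurable.of_uncurry_left (f := phaseDeriv m ε k) (measurable_phaseDeriv m ε k)
  have hE : MeasurableSet (cube c R ∩ phase m ε ξ ⁻¹' S) := (measurableSet_cube c R).inter (hφ hS)
  have hm : Measurable fun η => ENNReal.ofReal |phaseDeriv m ε k ξ η| := (continuous_abs.measurable.comp hφ').ennreal_ofReal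
  rw [← lintegral_indicator hE, lintegral_eq_lintegral_insertNth k (hm.indicator hE)]
  set Y : Set (Fin 2 → ℝ) :=
    Set.Icc (fun j => c (k.succAbove j)) (fun j => c (k.succAbove j) + R) with hY
  have hYm : MeasurableSet Y := measurableSet_Icc
  have hYv : volume Y = ENNReal.ofReal (R ^ 2) := by
    rw [hY, Real.volume_Icc_pi, ENNReal.ofReal_pow hR]
    simp
  -- Two null values of `y` are discarded so that both radicands stay positive even for `m = 0`.
  have hae : ∀ᵐ y : Fin 2 → ℝ, y ≠ 0 ∧ y ≠ fun j => ξ (k.succAbove j) :=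
    (Measure.ae_ne _ _).and (Measure.ae_ne _ _)
  have hpos : ∀ y : Fin 2 → ℝ, y ≠ 0 → 0 < m ^ 2 + ∑ j, y j ^ 2 := fun y hy => by
    obtain ⟨j, hj⟩ := Function.ne_iff.1 hy
    have h1 : 0 < ∑ j, y j ^ 2 :=
      Finset.sum_pos' (fun _ _ => sq_nonneg _) ⟨j, Finset.mem_univ _, by
        have : y j ≠ 0 := hj
        positivity⟩
    positivity
  have hinner : ∀ᵐ y : Fin 2 → ℝ, ∫⁻ t : ℝ, (cube c R ∩ phase m ε ξ ⁻¹' S).indicator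
      (fun η => ENNReal.ofReal |phaseDeriv m ε k ξ η|) (WithLp.toLp 2 (k.insertNth t y))
      ≤ Y.indicator (fun _ => 2 * volume S) y := by
    filter_upwards [hae] with y hy
    have hA := hpos y hy.1
    have hB := hpos (fun j => y j - ξ (k.succAbove j)) fun h =>
      hy.2 (funext fun j => sub_eq_zero.1 (congrFun h j))
    by_cases hyY : y ∈ Y
    · rw [Set.indicator_of_mem hyY]
      refine le_trans ?_ (setLIntegral_abs_deriv_phase_le hA hB (ξ k) hε hS)
      rw [← lintegral_indicator]
      · refine lintegral_mono fun t => ?_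
        have hbr : ∀ (s : ℝ) (z : Fin 2 → ℝ),
            bracket m (WithLp.toLp 2 (k.insertNth s z)) = √((m ^ 2 + ∑ j, z j ^ 2) + s ^ 2) :=
          fun s z => by
            rw [bracket, sq_norm_insertNth]; congr 1; ring
        have e1 : phase m ε ξ (WithLp.toLp 2 (k.insertNth t y))
            = √((m ^ 2 + ∑ j, y j ^ 2) + t ^ 2)
              - ε * √((m ^ 2 + ∑ j, (y j - ξ (k.succAbove j)) ^ 2) + (t - ξ k) ^ 2) := by
          rw [phase, toLp_insertNth_sub, hbr, hbr]
        have e2 : phaseDeriv m ε k ξ (WithLp.toLp 2 (k.insertNth t y))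
            = t / √((m ^ 2 + ∑ j, y j ^ 2) + t ^ 2) - ε * ((t - ξ k) /
              √((m ^ 2 + ∑ j, (y j - ξ (k.succAbove j)) ^ 2) + (t - ξ k) ^ 2)) := by
          rw [phaseDeriv, toLp_insertNth_sub, unitFreq, unitFreq, hbr, hbr]
          simp [div_eq_inv_mul]
        by_cases h : WithLp.toLp 2 (k.insertNth t y) ∈ cube c R ∩ phase m ε ξ ⁻¹' S
        · have h' := h.2
          rw [Set.mem_preimage, e1] at h'
          rw [Set.indicator_of_mem h, e2]
          exact le_of_eq (Eq.symm (Set.indicator_of_mem (by exact h') _))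
        · rw [Set.indicator_of_notMem h]
          exact zero_le
      · exact (Continuous.measurable (by fun_prop)) hS
    · rw [Set.indicator_of_notMem hyY]
      refine le_of_eq ?_
      refine (lintegral_congr fun t => Set.indicator_of_notMem (fun h => hyY ?_) _).trans
        lintegral_zero
      refine ⟨fun j => ?_, fun j => ?_⟩
      · simpa using (h.1 (k.succAbove j)).1
      · simpa using (h.1 (k.succAbove j)).2
  calc _ ≤ _ := lintegral_mono_ae hinner
    _ = _ := by
      rw [lintegral_indicator hYm, setLIntegral_const, hYv]
      ring

/-! ### Null structure: symbols, angles and the phase gradient -/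

/-- The angular null quantity `|a||b| - ε a·b` with `a = η/⟨η⟩_m` and `b = ζ/⟨ζ⟩_m`. -/
def angular (m ε : ℝ) (η ζ : E3) : ℝ :=
  ‖unitFreq m η‖ * ‖unitFreq m ζ‖ - ε * inner ℝ (unitFreq m η) (unitFreq m ζ)

theorem norm_le_bracket (m : ℝ) (η : E3) : ‖η‖ ≤ bracket m η :=
  Real.le_sqrt_of_sq_le (by nlinarith [sq_nonneg m])

theorem bracket_nonneg (m : ℝ) (η : E3) : 0 ≤ bracket m η := Real.sqrt_nonneg _

theorem norm_unitFreq_le_one (m : ℝ) (η : E3) : ‖unitFreq m η‖ ≤ 1 := by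
  rw [unitFreq, norm_smul, norm_inv, Real.norm_of_nonneg (bracket_nonneg m η), ← div_eq_inv_mul]
  exact div_le_one_of_le₀ (norm_le_bracket m η) (bracket_nonneg m η)

theorem abs_inner_le_of_sign {ε : ℝ} (hε : ε = 1 ∨ ε = -1) (a b : E3) :
    |ε * inner ℝ a b| ≤ ‖a‖ * ‖b‖ := by
  rcases hε with rfl | rfl <;> simpa using abs_real_inner_le_norm a b

theorem angular_nonneg {m ε : ℝ} (hε : ε = 1 ∨ ε = -1) (η ζ : E3) : 0 ≤ angular m ε η ζ := by
  have := (abs_le.1 (abs_inner_le_of_sign hε (unitFreq m η) (unitFreq m ζ))).2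
  unfold angular; linarith

theorem norm_unitFreq_mul_le_one (m : ℝ) (η ζ : E3) : ‖unitFreq m η‖ * ‖unitFreq m ζ‖ ≤ 1 :=
  mul_le_one₀ (norm_unitFreq_le_one m η) (norm_nonneg _) (norm_unitFreq_le_one m ζ)

theorem angular_le_two {m ε : ℝ} (hε : ε = 1 ∨ ε = -1) (η ζ : E3) : angular m ε η ζ ≤ 2 := by
  have := (abs_le.1 (abs_inner_le_of_sign hε (unitFreq m η) (unitFreq m ζ))).1
  have := norm_unitFreq_mul_le_one m η ζ
  unfold angular; linarith

theorem inner_eq_sum (a b : E3) : inner ℝ a b = a 0 * b 0 + a 1 * b 1 + a 2 * b 2 := by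
  rw [PiLp.inner_apply, Fin.sum_univ_three]
  simp [mul_comm]

theorem sq_norm_eq_sum (a : E3) : ‖a‖ ^ 2 = a 0 ^ 2 + a 1 ^ 2 + a 2 ^ 2 := by
  rw [EuclideanSpace.real_norm_sq_eq, Fin.sum_univ_three]

/-- The angular null quantity is controlled by the gradient of the phase. -/
theorem two_mul_angular_le {m ε : ℝ} (hε : ε = 1 ∨ ε = -1) (ξ η : E3) :
    2 * angular m ε η (η - ξ) ≤ (∑ k, |phaseDeriv m ε k ξ η|) ^ 2 := by
  have h1 : ∑ k, phaseDeriv m ε k ξ η ^ 2 ≤ (∑ k, |phaseDeriv m ε k ξ η|) ^ 2 := by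
    simp only [← sq_abs (phaseDeriv m ε _ ξ η)]
    exact Finset.sum_sq_le_sq_sum_of_nonneg fun _ _ => abs_nonneg _
  refine le_trans ?_ h1
  unfold angular phaseDeriv
  set a := unitFreq m η
  set b := unitFreq m (η - ξ)
  have hε2 : ε ^ 2 = 1 := by rcases hε with rfl | rfl <;> norm_num
  rw [Fin.sum_univ_three, inner_eq_sum]
  have ha := sq_norm_eq_sum a
  have hb := sq_norm_eq_sum b
  -- The identity behind this is `|a - εb|² - 2(|a||b| - ε a·b) = (|a| - |b|)²`.
  nlinarith [sq_nonneg (‖a‖ - ‖b‖)]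

/-- For parallel interactions the angular null quantity gains from small output frequencies. -/
theorem angular_one_mul_bracket_le (m : ℝ) (ξ η : E3) :
    angular m 1 η (η - ξ) * (2 * bracket m η * bracket m (η - ξ)) ≤ ‖ξ‖ ^ 2 := by
  -- The bracket can vanish when `m = 0`, but only at `x = 0`, where the identities below hold
  -- trivially.
  have hs : ∀ x : E3, bracket m x * (bracket m x)⁻¹ = 1 ∨ x = 0 := fun x => by
    rcases eq_or_ne (bracket m x) 0 with h | h
    · right
      have := norm_le_bracket m x
      rw [h] at this
      exact norm_le_zero_iff.1 this
    · left; exact mul_inv_cancel₀ h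
  have hsmul : ∀ x : E3, bracket m x • unitFreq m x = x := fun x => by
    rw [unitFreq, smul_smul]
    rcases hs x with h | h
    · rw [h, one_smul]
    · rw [h, smul_zero]
  have hn : ∀ x : E3, bracket m x * ‖unitFreq m x‖ = ‖x‖ := fun x => by
    conv_rhs => rw [← hsmul x, norm_smul, Real.norm_of_nonneg (bracket_nonneg m x)]
  have hi : bracket m η * bracket m (η - ξ) * inner ℝ (unitFreq m η) (unitFreq m (η - ξ))
      = inner ℝ η (η - ξ) := by
    have h : inner ℝ (bracket m η • unitFreq m η) (bracket m (η - ξ) • unitFreq m (η - ξ))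
        = bracket m η * bracket m (η - ξ) * inner ℝ (unitFreq m η) (unitFreq m (η - ξ)) := by
      rw [real_inner_smul_left, real_inner_smul_right]; ring
    rw [← h, hsmul, hsmul]
  have hx : ‖ξ‖ ^ 2 = ‖η‖ ^ 2 - 2 * inner ℝ η (η - ξ) + ‖η - ξ‖ ^ 2 := by
    rw [← norm_sub_sq_real]; congr 2; abel
  have e : angular m 1 η (η - ξ) * (2 * bracket m η * bracket m (η - ξ))
      = 2 * (‖η‖ * ‖η - ξ‖) - 2 * inner ℝ η (η - ξ) := by
    rw [← hi, ← hn η, ← hn (η - ξ), angular]; ring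
  rw [e, hx]
  nlinarith [sq_nonneg (‖η‖ - ‖η - ξ‖)]

theorem norm_vecDot_apply_sq_le (v : Fin 3 → ℝ) {M : Fin 3 → Mat4}
    (hM : ∀ k i j, ‖M k i j‖ ≤ 1) (i j : Fin 2 ⊕ Fin 2) :
    ‖vecDot v M i j‖ ^ 2 ≤ 3 * ∑ k, v k ^ 2 := by
  have h1 : ‖vecDot v M i j‖ ≤ ∑ k, |v k| := by
    rw [vecDot, Matrix.sum_apply]
    refine (norm_sum_le _ _).trans (Finset.sum_le_sum fun k _ => ?_)
    rw [Matrix.smul_apply, smul_eq_mul, norm_mul, Complex.norm_real, Real.norm_eq_abs]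
    exact mul_le_of_le_one_right (abs_nonneg _) (hM k i j)
  calc ‖vecDot v M i j‖ ^ 2 ≤ (∑ k, |v k|) ^ 2 := by gcongr
    _ ≤ 3 * ∑ k, |v k| ^ 2 := by
      simpa using sq_sum_le_card_mul_sum_sq (s := Finset.univ) (f := fun k : Fin 3 => |v k|)
    _ = _ := by simp only [sq_abs]

theorem norm_alpha_apply_le_one (k : Fin 3) (i j : Fin 2 ⊕ Fin 2) : ‖alpha k i j‖ ≤ 1 := by
  rw [alpha, beta, gamma, Matrix.fromBlocks_multiply]
  fin_cases k <;> rcases i with i | i <;> rcases j with j | j <;> fin_cases i <;> fin_cases j <;>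
    simp [pauli]

theorem norm_spin_apply_le_one (k : Fin 3) (i j : Fin 2 ⊕ Fin 2) : ‖spin k i j‖ ≤ 1 := by
  rw [spin]
  fin_cases k <;> rcases i with i | i <;> rcases j with j | j <;> fin_cases i <;> fin_cases j <;>
    simp [pauli]

/-- For the scalar symbol, `θ² ≤ 2θ`. For the second, the vector has squared length exactly `2|a||b|
θ`. For the third, Lagrange's identity gives `|a × b|² = θ (|a||b| + ε a·b)`. As `|a||b| ≤ 1`, the
factors besides `θ` are at most `2`; summing three matrices costs another `3`. -/
theorem norm_nullSymbol_apply_sq_le {m ε : ℝ} (hε : ε = 1 ∨ ε = -1) (l : Fin 3) (η ζ : E3)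
    (i j : Fin 2 ⊕ Fin 2) : ‖nullSymbol m ε l η ζ i j‖ ^ 2 ≤ 6 * angular m ε η ζ := by
  have h0 := angular_nonneg (m := m) hε η ζ
  have h2 := angular_le_two (m := m) hε η ζ
  have hab := norm_unitFreq_mul_le_one m η ζ
  have hin := (abs_le.1 (abs_inner_le_of_sign hε (unitFreq m η) (unitFreq m ζ))).2
  have hε2 : ε ^ 2 = 1 := by rcases hε with rfl | rfl <;> norm_num
  have hεn : ‖(ε : ℂ)‖ = 1 := by rcases hε with rfl | rfl <;> simp
  have ha := sq_norm_eq_sum (unitFreq m η)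
  have hb := sq_norm_eq_sum (unitFreq m ζ)
  have hi := inner_eq_sum (unitFreq m η) (unitFreq m ζ)
  have hang : angular m ε η ζ =
    ‖unitFreq m η‖ * ‖unitFreq m ζ‖ - ε * inner ℝ (unitFreq m η) (unitFreq m ζ) := rfl
  have hp : 0 ≤ ‖unitFreq m η‖ * ‖unitFreq m ζ‖ := by positivity
  fin_cases l
  · have : nullSymbol m ε 0 η ζ = ((angular m ε η ζ : ℝ) : ℂ) • (1 : Mat4) := rfl
    simp only [Fin.zero_eta]
    rw [this, Matrix.smul_apply, smul_eq_mul, norm_mul, Complex.norm_real, Real.norm_of_nonneg h0]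
    have h1 : ‖(1 : Mat4) i j‖ ≤ 1 := by
      rw [Matrix.one_apply]; split_ifs <;> simp
    have : angular m ε η ζ * ‖(1 : Mat4) i j‖ ≤ angular m ε η ζ := mul_le_of_le_one_right h0 h1
    nlinarith [mul_nonneg h0 (norm_nonneg ((1 : Mat4) i j))]
  · have : nullSymbol m ε 1 η ζ = -vecDot (fun k => unitFreq m η k * ‖unitFreq m ζ‖
        - ε * (unitFreq m ζ k * ‖unitFreq m η‖)) alpha := rfl
    simp only [Fin.mk_one]
    rw [this, Matrix.neg_apply, norm_neg]
    refine (norm_vecDot_apply_sq_le _ norm_alpha_apply_le_one i j).trans ?_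
    set a := unitFreq m η
    set b := unitFreq m ζ
    have e : ∑ k, (a k * ‖b‖ - ε * (b k * ‖a‖)) ^ 2
        = 2 * (‖a‖ * ‖b‖) * angular m ε η ζ := by
      rw [Fin.sum_univ_three, hang, hi]
      linear_combination (-‖b‖ ^ 2) * ha - ‖a‖ ^ 2 * hb +
        ‖a‖ ^ 2 * (b 0 ^ 2 + b 1 ^ 2 + b 2 ^ 2) * hε2
    rw [e]
    nlinarith
  · have : nullSymbol m ε 2 η ζ = (-(ε : ℂ) * Complex.I) • vecDot (crossProduct
        (fun k => unitFreq m η k) (fun k => unitFreq m ζ k)) spin := rfl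
    simp only [Fin.reduceFinMk]
    rw [this, Matrix.smul_apply, smul_eq_mul, norm_mul, norm_mul, norm_neg, hεn, Complex.norm_I,
      one_mul, one_mul]
    refine (norm_vecDot_apply_sq_le _ norm_spin_apply_le_one i j).trans ?_
    set a := unitFreq m η
    set b := unitFreq m ζ
    have e : ∑ k, (crossProduct (fun k => a k) (fun k => b k) : Fin 3 → ℝ) k ^ 2
        = angular m ε η ζ * (‖a‖ * ‖b‖ + ε * inner ℝ a b) := by
      have : angular m ε η ζ * (‖a‖ * ‖b‖ + ε * inner ℝ a b)
          = ‖a‖ ^ 2 * ‖b‖ ^ 2 - inner ℝ a b ^ 2 := by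
        rw [hang]; linear_combination (-(inner ℝ a b) ^ 2) * hε2
      rw [this, ha, hb, hi, Fin.sum_univ_three, cross_apply]
      simp
      ring
    rw [e]
    nlinarith

theorem norm_spinorInner_beta_mulVec_le {M : Mat4} {c : ℝ} (hM : ∀ i j, ‖M i j‖ ≤ c)
    (v w : Spinor) :
    ‖spinorInner (beta *ᵥ v.ofLp) (M *ᵥ w.ofLp)‖ ≤ 16 * c * ‖v‖ * ‖w‖ := by
  have hc : 0 ≤ c := (norm_nonneg _).trans (hM (Sum.inl 0) (Sum.inl 0))
  have hv : ∀ i, ‖(beta *ᵥ v.ofLp) i‖ ≤ ‖v‖ := fun i => by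
    have : ‖(beta *ᵥ v.ofLp) i‖ = ‖v i‖ := by
      rcases i with i | i <;> simp [beta, Matrix.mulVec, dotProduct, Fintype.sum_sum_type,
        Matrix.one_apply]
    rw [this]
    exact PiLp.norm_apply_le v i
  have hw : ∀ i, ‖(M *ᵥ w.ofLp) i‖ ≤ 4 * (c * ‖w‖) := fun i => by
    rw [Matrix.mulVec, dotProduct]
    refine (norm_sum_le _ _).trans ?_
    refine (Finset.sum_le_card_nsmul _ _ (c * ‖w‖) fun j _ => ?_).trans (by simp)
    rw [norm_mul]
    exact mul_le_mul (hM i j) (PiLp.norm_apply_le w j) (norm_nonneg _) hc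
  rw [spinorInner, dotProduct]
  refine (norm_sum_le _ _).trans ?_
  refine (Finset.sum_le_card_nsmul _ _ (‖v‖ * (4 * (c * ‖w‖))) fun j _ => ?_).trans ?_
  · rw [norm_mul, Pi.star_apply, norm_star]
    exact mul_le_mul (hv j) (hw j) (norm_nonneg _) (norm_nonneg _)
  · simp only [Finset.card_univ, Fintype.card_sum, Fintype.card_fin, nsmul_eq_mul]
    push_cast
    linarith

/-- The null structure of the integrand of the null form. -/
theorem norm_spinorInner_nullSymbol_sq_le {m ε : ℝ} (hε : ε = 1 ∨ ε = -1) (l : Fin 3) (η ζ : E3)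
    (v w : Spinor) :
    ‖spinorInner (beta *ᵥ v.ofLp) (nullSymbol m ε l η ζ *ᵥ w.ofLp)‖ ^ 2
      ≤ 1536 * angular m ε η ζ * ‖v‖ ^ 2 * ‖w‖ ^ 2 := by
  have h0 := angular_nonneg (m := m) hε η ζ
  have h := norm_spinorInner_beta_mulVec_le (c := √(6 * angular m ε η ζ))
    (fun i j => Real.le_sqrt_of_sq_le (norm_nullSymbol_apply_sq_le hε l η ζ i j)) v w
  -- Here `1536 = 16² · 6`, where `16 = 4 · 4` comes from the two sums over spinor components.
  calc _ ≤ (16 * √(6 * angular m ε η ζ) * ‖v‖ * ‖w‖) ^ 2 := by gcongr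
    _ = _ := by
      rw [mul_pow, mul_pow, mul_pow, Real.sq_sqrt (by positivity)]
      ring

/-! ### Fourier transforms of projected data -/

theorem measurable_hat (f : L2) : Measurable (hat f) :=
  (Lp.stronglyMeasurable _).measurable.comp (measurable_const_smul _)

theorem quasiMeasurePreserving_smul_inv_two_pi :
    Measure.QuasiMeasurePreserving (fun ξ : E3 => (2 * Real.pi)⁻¹ • ξ) volume volume := by
  refine ⟨measurable_const_smul _, ?_⟩
  rw [Measure.map_addHaar_smul _ (inv_ne_zero Real.two_pi_pos.ne')]
  exact Measure.smul_absolutelyContinuous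

theorem hat_fourierMultiplier_ae_eq (a : E3 → ℂ) (ha : Measurable a)
    (hb : ∃ C : ℝ, ∀ ξ, ‖a ξ‖ ≤ C) (f : L2) :
    hat (fourierMultiplier a ha hb f) =ᵐ[volume] fun ξ => a ξ • hat f ξ := by
  have h := quasiMeasurePreserving_smul_inv_two_pi.ae
    (memLp_multiplier a ha hb (𝓕 f : L2)).coeFn_toLp
  filter_upwards [h] with ξ hξ
  simp only [hat, fourierMultiplier]
  rw [FourierTransform.fourier_fourierInv_eq, hξ, smul_smul,
    mul_inv_cancel₀ Real.two_pi_pos.ne', one_smul]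

theorem lintegral_enorm_hat_sq (f : L2) :
    ∫⁻ ξ, ‖hat f ξ‖ₑ ^ 2 = ENNReal.ofReal ((2 * Real.pi) ^ 3) * ‖f‖ₑ ^ 2 := by
  have h := lintegral_comp_smul_volume (V := E3) Real.two_pi_pos
    fun x => ‖(𝓕 f : L2) x‖ₑ ^ 2
  rw [finrank_euclideanSpace_fin, ← eLpNorm_two_sq (𝓕 f : L2), ← Lp.enorm_def] at h
  rw [← ofReal_norm f, ← Lp.norm_fourier_eq f, ofReal_norm]
  exact h

theorem Cutoff.toFun_eq_zero (χ : Cutoff) {s : ℝ} (hs : 2 ≤ |s|) : χ.toFun s = 0 := by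
  by_contra h
  have := χ.tsupport_subset (subset_tsupport _ h)
  exact absurd (abs_lt.2 ⟨this.1, this.2⟩) (not_lt.2 hs)

/-- The lower bound is restricted to `1 < l` because `ρ₁ = χ` reaches down to zero frequency. -/
theorem rho_support (χ : Cutoff) {l s : ℝ} (hl : 1 ≤ l) (hs : 0 ≤ s) (h : rho χ l s ≠ 0) :
    s ≤ 2 * l ∧ (1 < l → l ≤ 2 * s) := by
  have hl0 : 0 < l := by linarith
  unfold rho at h
  rw [if_neg (not_lt.2 hl)] at h
  split_ifs at h with h1
  · subst h1
    refine ⟨?_, fun h => absurd h (lt_irrefl _)⟩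
    by_contra hc
    exact h (χ.toFun_eq_zero (by rw [abs_of_nonneg hs]; linarith))
  · constructor
    · by_contra hc
      push Not at hc
      have e1 : 2 ≤ s / l := by rw [le_div_iff₀ hl0]; linarith
      have e2 : 2 ≤ 2 * s / l := by rw [le_div_iff₀ hl0]; linarith
      rw [χ.toFun_eq_zero (e1.trans (le_abs_self _)), χ.toFun_eq_zero (e2.trans (le_abs_self _))] at h
      simp at h
    · intro _
      by_contra hc
      push Not at hc
      have e1 : |s / l| ≤ 1 := by
        rw [abs_of_nonneg (by positivity), div_le_one hl0]; linarith
      have e2 : |2 * s / l| ≤ 1 := by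
        rw [abs_of_nonneg (by positivity), div_le_one hl0]; linarith
      rw [χ.eq_one _ e1, χ.eq_one _ e2] at h
      simp at h

theorem exists_abs_rho_le (χ : Cutoff) : ∃ C : ℝ, 0 < C ∧ ∀ l s, |rho χ l s| ≤ C := by
  obtain ⟨C, hC⟩ := χ.bounded
  have h0 : 0 ≤ C := (norm_nonneg _).trans (hC 0)
  refine ⟨C + C + 1, by linarith, fun l s => ?_⟩
  unfold rho
  split_ifs
  · simpa using by linarith
  · exact (hC _).trans (by linarith)
  · exact (norm_sub_le _ _).trans ((add_le_add (hC _) (hC _)).trans (by linarith))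

/-- The frequency shell carrying `P_l`. -/
def shell (l : ℝ) : Set E3 := {η | ‖η‖ ≤ 2 * l ∧ (1 < l → l ≤ 2 * ‖η‖)}

theorem measurableSet_shell (l : ℝ) : MeasurableSet (shell l) := by
  unfold shell
  by_cases h : 1 < l
  · simp only [h, true_imp_iff]
    exact (measurableSet_le measurable_norm measurable_const).inter
      (measurableSet_le measurable_const (measurable_norm.const_mul 2))
  · simp only [h, false_imp_iff, and_true]
    exact measurableSet_le measurable_norm measurable_const

/-- The transform is determined only almost everywhere; this representative vanishes off the shell
at every point, so support conditions on the amplitude need no exceptional sets. -/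
theorem hat_freqProj_ae_eq_indicator (χ : Cutoff) {l : ℝ} (hl : 1 ≤ l) (f : L2) :
    hat (freqProj χ l f) =ᵐ[volume] (shell l).indicator (hat (freqProj χ l f)) := by
  filter_upwards [hat_fourierMultiplier_ae_eq _ (measurable_rho_norm χ l)
    (bounded_rho_norm χ l) f] with η hη
  by_cases h : η ∈ shell l
  · rw [Set.indicator_of_mem h]
  · rw [Set.indicator_of_notMem h]
    have h0 : rho χ l ‖η‖ = 0 := by
      by_contra hc
      exact h (rho_support χ hl (norm_nonneg η) hc)
    rw [freqProj, hη, h0]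
    simp

/-! ### Reduction to an oscillatory integral -/

theorem spinorInner_smul_smul (M : Mat4) (c d : ℂ) (v w : Spinor) :
    spinorInner (beta *ᵥ (c • v).ofLp) (M *ᵥ (d • w).ofLp)
      = c * star d * spinorInner (beta *ᵥ v.ofLp) (M *ᵥ w.ofLp) := by
  simp only [spinorInner, WithLp.ofLp_smul, Matrix.mulVec_smul, star_smul, smul_dotProduct,
    dotProduct_smul, smul_eq_mul]
  ring

theorem propagatorSymbol_mul_star (m ε t : ℝ) (ξ η : E3) :
    propagatorSymbol m t η * star (propagatorSymbol m (ε * t) (η - ξ))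
      = Complex.exp (-Complex.I * ((t * phase m ε ξ η : ℝ) : ℂ)) := by
  simp only [propagatorSymbol, phase, RCLike.star_def]
  rw [← Complex.exp_conj, ← Complex.exp_add]
  congr 1
  simp only [map_mul, map_neg, Complex.conj_I, Complex.conj_ofReal]
  push_cast
  ring

/-- The amplitude of the frequency-localized null form. -/
def amplitude (χ : Cutoff) (m ε μ : ℝ) (j : Fin 3) (F G : E3 → Spinor) (ξ η : E3) : ℂ :=
  ((rho χ μ ‖ξ‖ : ℝ) : ℂ) * spinorInner (beta *ᵥ (F η).ofLp)
    (nullSymbol m ε j η (η - ξ) *ᵥ (G (η - ξ)).ofLp)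

/-- The oscillatory integral with the phase of the null form and amplitude `h`. -/
def oscillatory (m ε : ℝ) (h : E3 → E3 → ℂ) (t : ℝ) (ξ : E3) : ℂ :=
  ∫ η, Complex.exp (-Complex.I * ((t * phase m ε ξ η : ℝ) : ℂ)) * h ξ η

/-- The propagators act as scalars on the transforms, and antilinearity in the second slot turns
their product into `e^{-itφ}`; the remaining amplitude is independent of time. -/
theorem waveNullForm_eq (χ : Cutoff) (m ε μ : ℝ) (j : Fin 3) (f g : L2) {F G : E3 → Spinor}
    (hF : hat f =ᵐ[volume] F) (hG : hat g =ᵐ[volume] G) (p : ℝ × E3) :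
    waveNullForm χ m ε μ j f g p
      = invFourier (oscillatory m ε (amplitude χ m ε μ j F G) p.1) p.2 := by
  rw [waveNullForm, projNullForm]
  congr 1
  ext ξ
  rw [oscillatory, nullFormHat, ← integral_const_mul]
  refine integral_congr_ae ?_
  have h1 := hat_fourierMultiplier_ae_eq _ (measurable_propagatorSymbol m p.1)
    (bounded_propagatorSymbol m p.1) f
  have h2 := (hat_fourierMultiplier_ae_eq _ (measurable_propagatorSymbol m (ε * p.1))
    (bounded_propagatorSymbol m (ε * p.1)) g)
  have hq := (measurePreserving_sub_right (volume : Measure E3) ξ).quasiMeasurePreserving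
  filter_upwards [h1, hF, hq.ae h2, hq.ae hG] with η e1 e2 e3 e4
  rw [propagator, propagator, e1, e2, e3, e4, spinorInner_smul_smul, propagatorSymbol_mul_star,
    amplitude]
  ring

theorem measurable_amplitude (χ : Cutoff) (m ε μ : ℝ) (j : Fin 3) {F G : E3 → Spinor}
    (hF : Measurable F) (hG : Measurable G) :
    Measurable fun p : E3 × E3 => amplitude χ m ε μ j F G p.1 p.2 := by
  have hFc : ∀ i, Measurable fun p : E3 × E3 => F p.2 i := fun i => by fun_prop
  have hGc : ∀ i, Measurable fun p : E3 × E3 => G (p.2 - p.1) i := fun i => by fun_prop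
  have hu : Measurable fun p : E3 × E3 => unitFreq m p.2 :=
    (measurable_unitFreq m).comp measurable_snd
  have hu' : Measurable fun p : E3 × E3 => unitFreq m (p.2 - p.1) :=
    (measurable_unitFreq m).comp (measurable_snd.sub measurable_fst)
  have huk : ∀ k, Measurable fun p : E3 × E3 => unitFreq m p.2 k :=
    fun k => (measurable_coord k).comp hu
  have huk' : ∀ k, Measurable fun p : E3 × E3 => unitFreq m (p.2 - p.1) k :=
    fun k => (measurable_coord k).comp hu'
  have hN : ∀ a b, Measurable fun p : E3 × E3 => nullSymbol m ε j p.2 (p.2 - p.1) a b := by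
    intro a b
    fin_cases j
    · simp only [nullSymbol, Fin.zero_eta, Matrix.cons_val_zero, Matrix.smul_apply, smul_eq_mul]
      exact (Complex.measurable_ofReal.comp
        ((hu.norm.mul hu'.norm).sub ((hu.inner hu').const_mul ε))).mul_const _
    · simp only [nullSymbol, Fin.mk_one, Matrix.cons_val_one, Matrix.cons_val_zero, vecDot,
        Matrix.neg_apply, Matrix.sum_apply, Matrix.smul_apply, smul_eq_mul]
      refine (Finset.measurable_sum _ fun k _ => ?_).neg
      exact (Complex.measurable_ofReal.comp (((huk k).mul hu'.norm).sub
        (((huk' k).mul hu.norm).const_mul ε))).mul_const _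
    · simp only [nullSymbol, Fin.reduceFinMk, Matrix.cons_val, vecDot, cross_apply,
        Matrix.smul_apply, smul_eq_mul, Fin.sum_univ_three, Matrix.cons_val_one,
        Matrix.cons_val_zero]
      have h : ∀ k l, Measurable fun p : E3 × E3 =>
          unitFreq m p.2 k * unitFreq m (p.2 - p.1) l - unitFreq m p.2 l *
            unitFreq m (p.2 - p.1) k := fun k l =>
        ((huk k).mul (huk' l)).sub ((huk l).mul (huk' k))
      exact ((((Complex.measurable_ofReal.comp (h 1 2)).mul_const _).add
        ((Complex.measurable_ofReal.comp (h 2 0)).mul_const _)).add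
        ((Complex.measurable_ofReal.comp (h 0 1)).mul_const _)).const_mul _
  unfold amplitude
  refine ((measurable_rho_norm χ μ).comp measurable_fst).mul ?_
  simp only [spinorInner, dotProduct, Matrix.mulVec, Pi.star_apply]
  refine Finset.measurable_sum _ fun a _ => ?_
  refine (Finset.measurable_sum _ fun b _ => (hFc b).const_mul _).mul ?_
  exact continuous_star.measurable.comp
    (Finset.measurable_sum _ fun b _ => (hN a b).mul (hGc b))

/-! ### Bilinear estimate on cubes -/

/-- The `ℓ¹` norm of the gradient of the phase. -/
def phaseGrad (m ε : ℝ) (ξ η : E3) : ℝ := ∑ k, |phaseDeriv m ε k ξ η|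

theorem measurable_phaseGrad (m ε : ℝ) : Measurable fun p : E3 × E3 => phaseGrad m ε p.1 p.2 := by
  unfold phaseGrad
  exact Finset.measurable_sum _ fun k _ =>
    continuous_abs.measurable.comp (measurable_phaseDeriv m ε k)

theorem phaseGrad_nonneg (m ε : ℝ) (ξ η : E3) : 0 ≤ phaseGrad m ε ξ η :=
  Finset.sum_nonneg fun _ _ => abs_nonneg _

theorem phaseGrad_le (m : ℝ) {ε : ℝ} (hε : ε = 1 ∨ ε = -1) (ξ η : E3) :
    phaseGrad m ε ξ η ≤ 6 := by
  have hu : ∀ (x : E3) (k : Fin 3), |unitFreq m x k| ≤ 1 := fun x k =>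
    (PiLp.norm_apply_le (unitFreq m x) k).trans (norm_unitFreq_le_one m x)
  have hk : ∀ k, |phaseDeriv m ε k ξ η| ≤ 2 := fun k => by
    have h1 := abs_le.1 (hu η k)
    have h2 := abs_le.1 (hu (η - ξ) k)
    rw [phaseDeriv, abs_le]
    rcases hε with rfl | rfl <;> constructor <;> linarith [h1.1, h1.2, h2.1, h2.2]
  rw [phaseGrad, Fin.sum_univ_three]
  linarith [hk 0, hk 1, hk 2]

theorem setLIntegral_phaseGrad_le (m : ℝ) {ε : ℝ} (hε : ε = 1 ∨ ε = -1)
    (ξ c : E3) {R : ℝ} (hR : 0 ≤ R) {S : Set ℝ} (hS : MeasurableSet S) :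
    ∫⁻ η in cube c R ∩ phase m ε ξ ⁻¹' S, ENNReal.ofReal (phaseGrad m ε ξ η)
      ≤ ENNReal.ofReal (6 * R ^ 2) * volume S := by
  have hm : ∀ k, Measurable fun η => ENNReal.ofReal |phaseDeriv m ε k ξ η| := fun k =>
    (continuous_abs.measurable.comp (Measurable.of_uncurry_left (f := phaseDeriv m ε k)
      (measurable_phaseDeriv m ε k))).ennreal_ofReal
  simp only [phaseGrad, ENNReal.ofReal_sum_of_nonneg fun _ _ => abs_nonneg _]
  rw [lintegral_finsetSum _ fun k _ => hm k]
  refine (Finset.sum_le_sum fun k _ => setLIntegral_abs_phaseDeriv_le m hε k ξ c hR hS).trans ?_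
  rw [Finset.sum_const, Finset.card_univ, Fintype.card_fin, nsmul_eq_mul,
    ENNReal.ofReal_mul (by norm_num), ENNReal.ofReal_ofNat, ← mul_assoc, ← mul_assoc]
  norm_num

/-- Domination of an amplitude by the phase gradient and a product of wave profiles. -/
structure Dominated (m ε κ : ℝ) (F G : E3 → Spinor) (h : E3 → E3 → ℂ) : Prop where
  measurable_left : Measurable F
  measurable_right : Measurable G
  measurable : Measurable fun p : E3 × E3 => h p.1 p.2
  nonneg : 0 ≤ κ
  bound : ∀ ξ η, ‖h ξ η‖ₑ ^ 2 ≤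
    ENNReal.ofReal (κ * phaseGrad m ε ξ η) * (‖F η‖ₑ ^ 2 * ‖G (η - ξ)‖ₑ ^ 2)

section Bounds

variable {m ε κ : ℝ} {F G : E3 → Spinor} {h : E3 → E3 → ℂ}

/-- A crude bound uniform in `ξ`, from the boundedness of the phase gradient; it supplies
integrability and boundedness, not the final constants. -/
theorem Dominated.lintegral_sq_le (hε : ε = 1 ∨ ε = -1) (hd : Dominated m ε κ F G h) (ξ : E3) :
    (∫⁻ η, ‖h ξ η‖ₑ) ^ 2 ≤
      ENNReal.ofReal (κ * 6) * (∫⁻ η, ‖F η‖ₑ ^ 2) * ∫⁻ η, ‖G η‖ₑ ^ 2 := by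
  have hFm := hd.measurable_left
  have hGm := hd.measurable_right
  rw [← lintegral_sub_right_eq_self (fun η => ‖G η‖ₑ ^ 2) ξ,
    ← lintegral_const_mul (ENNReal.ofReal (κ * 6)) (hFm.enorm.pow_const 2)]
  refine lintegral_sq_le_of_sq_le_mul (by fun_prop) (by fun_prop) fun η => ?_
  refine (hd.bound ξ η).trans ?_
  rw [mul_assoc]
  gcongr
  · exact hd.nonneg
  · exact phaseGrad_le m hε ξ η

theorem Dominated.integrable (hε : ε = 1 ∨ ε = -1) (hd : Dominated m ε κ F G h)
    (hF : ∫⁻ η, ‖F η‖ₑ ^ 2 ≠ ⊤) (hG : ∫⁻ η, ‖G η‖ₑ ^ 2 ≠ ⊤) (ξ : E3) : Integrable (h ξ) := by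
  refine ⟨(Measurable.of_uncurry_left (f := h) hd.measurable).aestronglyMeasurable, ?_⟩
  rw [hasFiniteIntegral_iff_enorm, lt_top_iff_ne_top]
  intro ht
  have := hd.lintegral_sq_le hε ξ
  rw [ht] at this
  have h2 : ENNReal.ofReal (κ * 6) * (∫⁻ η, ‖F η‖ₑ ^ 2) * ∫⁻ η, ‖G η‖ₑ ^ 2 ≠ ⊤ :=
    ENNReal.mul_ne_top (ENNReal.mul_ne_top ENNReal.ofReal_ne_top hF) hG
  simp at this
  exact h2 (by simpa using this)

theorem measurable_oscillatory (hh : Measurable fun p : E3 × E3 => h p.1 p.2) :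
    Measurable fun p : ℝ × E3 => oscillatory m ε h p.1 p.2 := by
  have hp : Measurable fun q : (ℝ × E3) × E3 => (q.1.2, q.2) := by fun_prop
  have hφ := (measurable_phase m ε).comp hp
  have hh' := hh.comp hp
  simp only [Function.comp_def] at hφ hh'
  have : StronglyMeasurable fun q : (ℝ × E3) × E3 =>
      Complex.exp (-Complex.I * ((q.1.1 * phase m ε q.1.2 q.2 : ℝ) : ℂ)) * h q.1.2 q.2 :=
    Measurable.stronglyMeasurable (by fun_prop)
  exact (this.integral_prod_right').measurable

/-- For each `ξ` the dual coarea bound is applied with the phase gradient, cut off to the cube, as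
weight. Integrating in `ξ` then decouples `F` and `G`. The cube may move with `ξ`, since only its
side enters. -/
theorem Dominated.lintegral_oscillatory_sq_le (hε : ε = 1 ∨ ε = -1)
    (hd : Dominated m ε κ F G h)
    (hF : ∫⁻ η, ‖F η‖ₑ ^ 2 ≠ ⊤) (hG : ∫⁻ η, ‖G η‖ₑ ^ 2 ≠ ⊤) {c : E3 → E3} {R : ℝ} (hR : 0 ≤ R)
    (hc : ∀ ξ η, h ξ η ≠ 0 → η ∈ cube (c ξ) R) :
    ∫⁻ p : ℝ × E3, ‖oscillatory m ε h p.1 p.2‖ₑ ^ 2 ≤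
      ENNReal.ofReal (2 * Real.pi * (κ * (6 * R ^ 2))) *
        ((∫⁻ η, ‖F η‖ₑ ^ 2) * ∫⁻ η, ‖G η‖ₑ ^ 2) := by
  have hFm := hd.measurable_left
  have hGm := hd.measurable_right
  have hξ : ∀ ξ, ∫⁻ t : ℝ, ‖oscillatory m ε h t ξ‖ₑ ^ 2 ≤
      ENNReal.ofReal (2 * Real.pi * (κ * (6 * R ^ 2))) *
        ∫⁻ η, ‖F η‖ₑ ^ 2 * ‖G (η - ξ)‖ₑ ^ 2 := by
    intro ξ
    have hφ : Measurable (phase m ε ξ) :=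
      Measurable.of_uncurry_left (f := phase m ε) (measurable_phase m ε)
    have hg : Measurable (phaseGrad m ε ξ) :=
      Measurable.of_uncurry_left (f := phaseGrad m ε) (measurable_phaseGrad m ε)
    have hw : Measurable ((cube (c ξ) R).indicator
        fun η => ENNReal.ofReal (κ * phaseGrad m ε ξ η)) :=
      (hg.const_mul κ).ennreal_ofReal.indicator (measurableSet_cube _ _)
    have key := lintegral_enorm_oscillatory_sq_le (ν := volume) hφ hw
      (M := ENNReal.ofReal (κ * (6 * R ^ 2))) (fun S hS => ?_) (hd.integrable hε hF hG ξ)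
      (k := fun η => ‖F η‖ₑ ^ 2 * ‖G (η - ξ)‖ₑ ^ 2) (by fun_prop) fun η => ?_
    · rwa [← ENNReal.ofReal_mul Real.two_pi_pos.le] at key
    · rw [setLIntegral_indicator (measurableSet_cube _ _)]
      simp only [ENNReal.ofReal_mul hd.nonneg]
      rw [lintegral_const_mul _ hg.ennreal_ofReal, mul_assoc]
      gcongr
      exact setLIntegral_phaseGrad_le m hε ξ (c ξ) hR hS
    · by_cases h0 : h ξ η = 0
      · simp [h0]
      · rw [Set.indicator_of_mem (hc ξ η h0)]
        exact hd.bound ξ η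
  have hm : Measurable fun p : ℝ × E3 => ‖oscillatory m ε h p.1 p.2‖ₑ ^ 2 :=
    (measurable_oscillatory hd.measurable).enorm.pow_const 2
  rw [Measure.volume_eq_prod, lintegral_prod_symm _ hm.aemeasurable]
  refine (lintegral_mono hξ).trans (le_of_eq ?_)
  rw [lintegral_const_mul _ (Measurable.lintegral_prod_right'
    (f := fun p : E3 × E3 => ‖F p.2‖ₑ ^ 2 * ‖G (p.2 - p.1)‖ₑ ^ 2) (by fun_prop))]
  congr 1
  rw [lintegral_lintegral_swap (by fun_prop)]
  have : ∀ η, ∫⁻ ξ, ‖F η‖ₑ ^ 2 * ‖G (η - ξ)‖ₑ ^ 2 = ‖F η‖ₑ ^ 2 * ∫⁻ ζ, ‖G ζ‖ₑ ^ 2 := fun η => by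
    rw [lintegral_const_mul _ (by fun_prop), lintegral_sub_left_eq_self (fun ζ => ‖G ζ‖ₑ ^ 2) η]
  simp only [this]
  rw [lintegral_mul_const _ (by fun_prop)]

end Bounds

/-! ### Almost orthogonality of frequency cells -/

theorem finset_sum_sq_le_of_sq_le_mul {ι : Type*} (s : Finset ι) {x a b : ι → ENNReal}
    (h : ∀ i, x i ^ 2 ≤ a i * b i) :
    (∑ i ∈ s, x i) ^ 2 ≤ (∑ i ∈ s, a i) * ∑ i ∈ s, b i := by
  let _ : MeasurableSpace s := ⊤
  have key := lintegral_sq_le_of_sq_le_mul (ν := (Measure.count : Measure s))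
    (h := fun i => x i) (u := fun i => a i) (v := fun i => b i)
    measurable_from_top.aemeasurable measurable_from_top.aemeasurable fun i => h i
  simpa only [lintegral_count, tsum_fintype, Finset.sum_coe_sort s] using key

/-- The index of the lattice cell of side `μ` containing `η`. -/
def cellIndex (μ : ℝ) (η : E3) (k : Fin 3) : ℤ := ⌊η k / μ⌋

/-- The lattice cell of side `μ` with index `n`. -/
def cell (μ : ℝ) (n : Fin 3 → ℤ) : Set E3 := {η | cellIndex μ η = n}

/-- The union of the lattice cells near the cell with index `n`. -/
def cellNhd (μ : ℝ) (n : Fin 3 → ℤ) : Set E3 := {ζ | ∀ k, |cellIndex μ ζ k - n k| ≤ 2}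

theorem measurable_cellIndex (μ : ℝ) : Measurable (cellIndex μ) := by
  refine measurable_pi_lambda _ fun k => ?_
  exact Int.measurable_floor.comp ((measurable_coord k).div_const μ)

theorem measurableSet_cell (μ : ℝ) (n : Fin 3 → ℤ) : MeasurableSet (cell μ n) :=
  (measurable_cellIndex μ) (measurableSet_singleton n)

theorem measurableSet_cellNhd (μ : ℝ) (n : Fin 3 → ℤ) : MeasurableSet (cellNhd μ n) :=
  (measurable_cellIndex μ) (Set.to_countable {p : Fin 3 → ℤ | ∀ k, |p k - n k| ≤ 2}).measurableSet

theorem cell_subset_cube {μ : ℝ} (hμ : 0 < μ) (n : Fin 3 → ℤ) :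
    cell μ n ⊆ cube (WithLp.toLp 2 fun k => μ * n k) μ := by
  intro η hη k
  have hk : ⌊η k / μ⌋ = n k := congrFun hη k
  have h1 := Int.floor_le (η k / μ)
  have h2 := (Int.lt_floor_add_one (η k / μ)).le
  rw [hk] at h1 h2
  rw [le_div_iff₀ hμ] at h1
  rw [div_le_iff₀ hμ] at h2
  simp only
  constructor <;> linarith

/-- A shift by at most `2μ` in each coordinate changes the cell index by at most `2`. -/
theorem sub_mem_cellNhd {μ : ℝ} (hμ : 0 < μ) {n : Fin 3 → ℤ} {ξ η : E3} (hξ : ‖ξ‖ ≤ 2 * μ)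
    (hη : η ∈ cell μ n) : η - ξ ∈ cellNhd μ n := by
  intro k
  have hk : ⌊η k / μ⌋ = n k := congrFun hη k
  have hx := abs_le.1 ((PiLp.norm_apply_le ξ k).trans hξ)
  have e : cellIndex μ (η - ξ) k = ⌊η k / μ - ξ k / μ⌋ := by
    simp [cellIndex, sub_div]
  have h1 : ξ k / μ ≤ 2 := by rw [div_le_iff₀ hμ]; exact hx.2
  have h2 : -2 ≤ ξ k / μ := by rw [le_div_iff₀ hμ]; linarith [hx.1]
  have h3 : ⌊η k / μ⌋ - 2 ≤ ⌊η k / μ - ξ k / μ⌋ := by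
    rw [← Int.floor_sub_ofNat]; exact Int.floor_mono (by linarith)
  have h4 : ⌊η k / μ - ξ k / μ⌋ ≤ ⌊η k / μ⌋ + 2 := by
    rw [← Int.floor_add_ofNat]; exact Int.floor_mono (by linarith)
  rw [e, abs_le, ← hk]
  constructor <;> linarith

theorem sum_indicator_cell_le (μ : ℝ) (s : Finset (Fin 3 → ℤ)) (η : E3) (y : ENNReal) :
    ∑ n ∈ s, (cell μ n).indicator (fun _ => y) η ≤ y := by
  classical
  have : ∀ n, (cell μ n).indicator (fun _ => y) η = if cellIndex μ η = n then y else 0 := fun n => by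
    simp [Set.indicator_apply, cell]
  simp only [this, Finset.sum_ite_eq]
  split_ifs <;> simp

theorem sum_indicator_cellNhd_le (μ : ℝ) (s : Finset (Fin 3 → ℤ)) (ζ : E3) (y : ENNReal) :
    ∑ n ∈ s, (cellNhd μ n).indicator (fun _ => y) ζ ≤ 125 * y := by
  classical
  have : ∀ n, (cellNhd μ n).indicator (fun _ => y) ζ = if ζ ∈ cellNhd μ n then y else 0 := fun n => by
    simp [Set.indicator_apply]
  simp only [this]
  rw [← Finset.sum_filter, Finset.sum_const, nsmul_eq_mul]
  gcongr
  -- Each coordinate of `n` lies among `5` consecutive integers, and `125 = 5³`.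
  have hsub : s.filter (fun n => ζ ∈ cellNhd μ n) ⊆
      Fintype.piFinset fun k => Finset.Icc (cellIndex μ ζ k - 2) (cellIndex μ ζ k + 2) := by
    intro n hn
    rw [Fintype.mem_piFinset]
    intro k
    have := abs_le.1 ((Finset.mem_filter.1 hn).2 k)
    rw [Finset.mem_Icc]
    constructor <;> linarith [this.1, this.2]
  have hcard := Finset.card_le_card hsub
  rw [Fintype.card_piFinset] at hcard
  have e : ∀ k, (Finset.Icc (cellIndex μ ζ k - 2) (cellIndex μ ζ k + 2)).card = 5 := fun k => by
    rw [Int.card_Icc]; omega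
  simp only [e, Finset.prod_const, Finset.card_univ, Fintype.card_fin] at hcard
  exact_mod_cast hcard

theorem enorm_indicator_sq {α V : Type*} [NormedAddCommGroup V] (S : Set α) (f : α → V) (x : α) :
    ‖S.indicator f x‖ₑ ^ 2 = S.indicator (fun _ => ‖f x‖ₑ ^ 2) x := by
  by_cases h : x ∈ S <;> simp [h]

section Bounds

variable {m ε κ : ℝ} {F G : E3 → Spinor} {h : E3 → E3 → ℂ}

theorem Dominated.localize (hd : Dominated m ε κ F G h) {μ : ℝ} (hμ : 0 < μ)
    (hs : ∀ ξ η, h ξ η ≠ 0 → ‖ξ‖ ≤ 2 * μ) (n : Fin 3 → ℤ) :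
    Dominated m ε κ ((cell μ n).indicator F) ((cellNhd μ n).indicator G)
      fun ξ => (cell μ n).indicator (h ξ) where
  measurable_left := hd.measurable_left.indicator (measurableSet_cell μ n)
  measurable_right := hd.measurable_right.indicator (measurableSet_cellNhd μ n)
  measurable := hd.measurable.indicator (measurable_snd (measurableSet_cell μ n))
  nonneg := hd.nonneg
  bound ξ η := by
    by_cases hη : η ∈ cell μ n
    · rw [Set.indicator_of_mem hη, Set.indicator_of_mem hη]
      by_cases h0 : h ξ η = 0
      · simp [h0]
      · rw [Set.indicator_of_mem (sub_mem_cellNhd hμ (hs ξ η h0) hη)]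
        exact hd.bound ξ η
    · simp [hη]

/-- Almost orthogonality: for output frequencies of size `μ` it suffices to consider interactions
of frequency cells of side `μ`. -/
theorem Dominated.lintegral_oscillatory_sq_le_of_output (hε : ε = 1 ∨ ε = -1)
    (hd : Dominated m ε κ F G h)
    (hF : ∫⁻ η, ‖F η‖ₑ ^ 2 ≠ ⊤) (hG : ∫⁻ η, ‖G η‖ₑ ^ 2 ≠ ⊤) {μ L : ℝ} (hμ : 0 < μ)
    (hs : ∀ ξ η, h ξ η ≠ 0 → ‖ξ‖ ≤ 2 * μ) (hL : ∀ ξ η, h ξ η ≠ 0 → ‖η‖ ≤ L) :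
    ∫⁻ p : ℝ × E3, ‖oscillatory m ε h p.1 p.2‖ₑ ^ 2 ≤
      ENNReal.ofReal (125 * (2 * Real.pi * (κ * (6 * μ ^ 2)))) *
        ((∫⁻ η, ‖F η‖ₑ ^ 2) * ∫⁻ η, ‖G η‖ₑ ^ 2) := by
  have hFm := hd.measurable_left
  have hGm := hd.measurable_right
  -- The radius `L` serves only to make the set of cells finite and does not enter the bound.
  set s : Finset (Fin 3 → ℤ) := Fintype.piFinset fun _ => Finset.Icc ⌊-L / μ⌋ ⌊L / μ⌋ with hsdef
  have hmem : ∀ ξ η, h ξ η ≠ 0 → cellIndex μ η ∈ s := fun ξ η h0 => by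
    rw [hsdef, Fintype.mem_piFinset]
    intro k
    have := abs_le.1 ((PiLp.norm_apply_le η k).trans (hL ξ η h0))
    rw [Finset.mem_Icc]
    exact ⟨Int.floor_mono (by gcongr; exact this.1), Int.floor_mono (by gcongr; exact this.2)⟩
  have hsum : ∀ ξ η, h ξ η = ∑ n ∈ s, (cell μ n).indicator (h ξ) η := fun ξ η => by
    classical
    have : ∀ n, (cell μ n).indicator (h ξ) η = if cellIndex μ η = n then h ξ η else 0 := fun n => by
      simp [Set.indicator_apply, cell]
    simp only [this, Finset.sum_ite_eq]
    split_ifs with h1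
    · rfl
    · by_contra h0
      exact h1 (hmem ξ η h0)
  have hosc : (fun p : ℝ × E3 => oscillatory m ε h p.1 p.2)
      = ∑ n ∈ s, fun p : ℝ × E3 => oscillatory m ε (fun ξ => (cell μ n).indicator (h ξ)) p.1 p.2 := by
    ext p
    rw [Finset.sum_apply]
    simp only [oscillatory]
    rw [← integral_finsetSum]
    · refine integral_congr_ae (Filter.Eventually.of_forall fun η => ?_)
      simp only
      rw [← Finset.mul_sum, ← hsum]
    · intro n _
      have hφ : Measurable (phase m ε p.2) :=
        Measurable.of_uncurry_left (f := phase m ε) (measurable_phase m ε)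
      refine ((hd.integrable hε hF hG p.2).indicator (measurableSet_cell μ n)).bdd_mul (c := 1)
        (Measurable.aestronglyMeasurable (by fun_prop)) ?_
      exact Filter.Eventually.of_forall fun η => (norm_exp_neg_I_mul_ofReal _).le
  have hFle : ∀ n, ∫⁻ η, ‖(cell μ n).indicator F η‖ₑ ^ 2 ≠ ⊤ := fun n =>
    ne_top_of_le_ne_top hF (lintegral_mono fun η => by
      rw [enorm_indicator_sq]; exact Set.indicator_le_self _ _ _)
  have hGle : ∀ n, ∫⁻ η, ‖(cellNhd μ n).indicator G η‖ₑ ^ 2 ≠ ⊤ := fun n =>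
    ne_top_of_le_ne_top hG (lintegral_mono fun η => by
      rw [enorm_indicator_sq]; exact Set.indicator_le_self _ _ _)
  set C : ENNReal := ENNReal.ofReal (2 * Real.pi * (κ * (6 * μ ^ 2))) with hC
  have hpiece : ∀ n, eLpNorm (fun p : ℝ × E3 =>
      oscillatory m ε (fun ξ => (cell μ n).indicator (h ξ)) p.1 p.2) 2 volume ^ 2 ≤
      (C * ∫⁻ η, ‖(cell μ n).indicator F η‖ₑ ^ 2) *
        ∫⁻ η, ‖(cellNhd μ n).indicator G η‖ₑ ^ 2 := fun n => by
    rw [eLpNorm_two_sq, mul_assoc]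
    refine (hd.localize hμ hs n).lintegral_oscillatory_sq_le hε (hFle n) (hGle n) hμ.le
      (c := fun _ => WithLp.toLp 2 fun k => μ * n k) fun ξ η h0 => ?_
    by_contra hc
    exact h0 (Set.indicator_of_notMem (fun hη => hc (cell_subset_cube hμ n hη)) _)
  have hsumF : ∑ n ∈ s, ∫⁻ η, ‖(cell μ n).indicator F η‖ₑ ^ 2 ≤ ∫⁻ η, ‖F η‖ₑ ^ 2 := by
    rw [← lintegral_finsetSum _ fun n _ =>
      (hFm.indicator (measurableSet_cell μ n)).enorm.pow_const 2]
    refine lintegral_mono fun η => ?_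
    simp only [enorm_indicator_sq]
    exact sum_indicator_cell_le μ s η _
  have hsumG : ∑ n ∈ s, ∫⁻ η, ‖(cellNhd μ n).indicator G η‖ₑ ^ 2 ≤ 125 * ∫⁻ η, ‖G η‖ₑ ^ 2 := by
    rw [← lintegral_finsetSum _ fun n _ =>
      (hGm.indicator (measurableSet_cellNhd μ n)).enorm.pow_const 2,
      ← lintegral_const_mul _ (hGm.enorm.pow_const 2)]
    refine lintegral_mono fun η => ?_
    simp only [enorm_indicator_sq]
    exact sum_indicator_cellNhd_le μ s η _
  rw [← eLpNorm_two_sq, hosc]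
  -- The triangle inequality loses nothing essential: each cell of `F` meets only the nearby cells
  -- of `G`, so Cauchy–Schwarz over `n` restores the two full norms.
  calc _ ≤ (∑ n ∈ s, eLpNorm (fun p : ℝ × E3 =>
        oscillatory m ε (fun ξ => (cell μ n).indicator (h ξ)) p.1 p.2) 2 volume) ^ 2 := by
        gcongr
        refine eLpNorm_sum_le (fun n _ => ?_) (by norm_num)
        exact (measurable_oscillatory (hd.localize hμ hs n).measurable).aestronglyMeasurable
    _ ≤ (∑ n ∈ s, C * ∫⁻ η, ‖(cell μ n).indicator F η‖ₑ ^ 2) *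
        ∑ n ∈ s, ∫⁻ η, ‖(cellNhd μ n).indicator G η‖ₑ ^ 2 :=
        finset_sum_sq_le_of_sq_le_mul s hpiece
    _ ≤ (C * ∫⁻ η, ‖F η‖ₑ ^ 2) * (125 * ∫⁻ η, ‖G η‖ₑ ^ 2) := by
        rw [← Finset.mul_sum]
        gcongr
    _ = _ := by
        rw [ENNReal.ofReal_mul (by norm_num), ENNReal.ofReal_ofNat, ← hC]
        ring

end Bounds

/-! ### Return to space-time -/

theorem measurable_invFourier_uncurry {V : ℝ → E3 → ℂ} (hV : Measurable fun p : ℝ × E3 => V p.1 p.2) :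
    Measurable fun p : ℝ × E3 => invFourier (V p.1) p.2 := by
  have hp : Measurable fun q : (ℝ × E3) × E3 => (q.1.1, q.2) := by fun_prop
  have hV' := hV.comp hp
  simp only [Function.comp_def] at hV'
  have : StronglyMeasurable fun q : (ℝ × E3) × E3 =>
      Complex.exp (Complex.I * ((inner ℝ q.1.2 q.2 : ℝ) : ℂ)) * V q.1.1 q.2 :=
    Measurable.stronglyMeasurable (by fun_prop)
  exact (this.integral_prod_right').measurable.const_mul _

/-- Boundedness and bounded support place each time slice in `L¹ ∩ L²`; the constant is `(2π)⁻⁶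
(2π)³`. -/
theorem lintegral_invFourier_sq {V : ℝ → E3 → ℂ} (hV : Measurable fun p : ℝ × E3 => V p.1 p.2)
    {B r : ℝ} (hB : ∀ t ξ, ‖V t ξ‖ ≤ B) (hr : ∀ t ξ, V t ξ ≠ 0 → ‖ξ‖ ≤ r) :
    ∫⁻ p : ℝ × E3, ‖invFourier (V p.1) p.2‖ₑ ^ 2 =
      ENNReal.ofReal (((2 * Real.pi) ^ 3)⁻¹) * ∫⁻ p : ℝ × E3, ‖V p.1 p.2‖ₑ ^ 2 := by
  have hpi := Real.two_pi_pos
  have hm : Measurable fun p : ℝ × E3 => ‖invFourier (V p.1) p.2‖ₑ ^ 2 :=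
    (measurable_invFourier_uncurry hV).enorm.pow_const 2
  have hVm : Measurable fun p : ℝ × E3 => ‖V p.1 p.2‖ₑ ^ 2 := hV.enorm.pow_const 2
  rw [Measure.volume_eq_prod, lintegral_prod _ hm.aemeasurable, lintegral_prod _ hVm.aemeasurable,
    ← lintegral_const_mul _ hVm.lintegral_prod_right']
  refine lintegral_congr fun t => ?_
  have hVt : Measurable (V t) := Measurable.of_uncurry_left (f := V) hV
  have h1 : Integrable (V t) := by
    have hb : IntegrableOn (V t) (Metric.closedBall 0 r) :=
      Measure.integrableOn_of_bounded (M := B) measure_closedBall_lt_top.ne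
        hVt.aestronglyMeasurable (Filter.Eventually.of_forall fun ξ => hB t ξ)
    refine (integrableOn_iff_integrable_of_support_subset fun ξ hξ => ?_).1 hb
    simpa using hr t ξ hξ
  have h2 := memLp_two_of_integrable_of_bound h1 (hB t)
  have key := lintegral_enorm_integral_exp_sq h1 h2
  rw [finrank_euclideanSpace_fin] at key
  have hc : ‖((2 * Real.pi : ℝ) : ℂ)⁻¹ ^ 3‖ₑ ^ 2 = ENNReal.ofReal (((2 * Real.pi) ^ 3)⁻¹ ^ 2) := by
    rw [← ofReal_norm, ← ENNReal.ofReal_pow (norm_nonneg _), norm_pow, norm_inv, Complex.norm_real,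
      Real.norm_of_nonneg hpi.le, inv_pow]
  simp only [invFourier, enorm_mul, mul_pow (M := ENNReal)]
  rw [lintegral_const_mul', key, hc, ← mul_assoc, ← ENNReal.ofReal_mul (by positivity)]
  · congr 2
    field_simp
  · rw [hc]; exact ENNReal.ofReal_ne_top

theorem Dominated.norm_oscillatory_bounded {m ε κ : ℝ} {F G : E3 → Spinor} {h : E3 → E3 → ℂ}
    (hε : ε = 1 ∨ ε = -1) (hd : Dominated m ε κ F G h)
    (hF : ∫⁻ η, ‖F η‖ₑ ^ 2 ≠ ⊤) (hG : ∫⁻ η, ‖G η‖ₑ ^ 2 ≠ ⊤) :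
    ∃ B : ℝ, ∀ t ξ, ‖oscillatory m ε h t ξ‖ ≤ B := by
  set A : ENNReal := ENNReal.ofReal (κ * 6) * (∫⁻ η, ‖F η‖ₑ ^ 2) * ∫⁻ η, ‖G η‖ₑ ^ 2 with hA
  have hAt : A ≠ ⊤ := ENNReal.mul_ne_top (ENNReal.mul_ne_top ENNReal.ofReal_ne_top hF) hG
  refine ⟨√A.toReal, fun t ξ => Real.le_sqrt_of_sq_le ?_⟩
  have h1 : ‖oscillatory m ε h t ξ‖ₑ ≤ ∫⁻ η, ‖h ξ η‖ₑ := by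
    refine (enorm_integral_le_lintegral_enorm _).trans (le_of_eq (lintegral_congr fun η => ?_))
    rw [enorm_mul, ← ofReal_norm, norm_exp_neg_I_mul_ofReal, ENNReal.ofReal_one, one_mul]
  have h2 : ‖oscillatory m ε h t ξ‖ₑ ^ 2 ≤ A :=
    (pow_le_pow_left' h1 2).trans (hd.lintegral_sq_le hε ξ)
  rw [← ofReal_norm, ← ENNReal.ofReal_pow (norm_nonneg _)] at h2
  exact (ENNReal.ofReal_le_iff_le_toReal hAt).1 h2

/-- One factor `√θ` of the null gain is spent on the phase gradient, which the coarea argument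
absorbs; the other is kept as the smallness `δ`. -/
theorem dominated_amplitude {χ : Cutoff} {m ε μ : ℝ} (hε : ε = 1 ∨ ε = -1) (j : Fin 3)
    {F G : E3 → Spinor} (hF : Measurable F) (hG : Measurable G) {c : ℝ}
    (hc : ∀ l s, |rho χ l s| ≤ c) {δ : ℝ} (hδ : 0 ≤ δ)
    (hang : ∀ ξ η, amplitude χ m ε μ j F G ξ η ≠ 0 → angular m ε η (η - ξ) ≤ δ ^ 2) :
    Dominated m ε (1536 * c ^ 2 * δ) F G (amplitude χ m ε μ j F G) where
  measurable_left := hF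
  measurable_right := hG
  measurable := measurable_amplitude χ m ε μ j hF hG
  nonneg := by positivity
  bound ξ η := by
    by_cases h0 : amplitude χ m ε μ j F G ξ η = 0
    · simp [h0]
    have hA := angular_nonneg (m := m) hε η (η - ξ)
    have hP := phaseGrad_nonneg m ε ξ η
    have h1 : √(angular m ε η (η - ξ)) ≤ δ := Real.sqrt_le_iff.2 ⟨hδ, hang ξ η h0⟩
    have h2 : √(angular m ε η (η - ξ)) ≤ phaseGrad m ε ξ η := by
      refine Real.sqrt_le_iff.2 ⟨hP, ?_⟩
      have : 2 * angular m ε η (η - ξ) ≤ phaseGrad m ε ξ η ^ 2 := two_mul_angular_le hε ξ η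
      linarith
    have h3 : angular m ε η (η - ξ) ≤ δ * phaseGrad m ε ξ η := by
      calc _ = √(angular m ε η (η - ξ)) * √(angular m ε η (η - ξ)) := (Real.mul_self_sqrt hA).symm
        _ ≤ _ := mul_le_mul h1 h2 (Real.sqrt_nonneg _) hδ
    have hreal : ‖amplitude χ m ε μ j F G ξ η‖ ^ 2 ≤
        1536 * c ^ 2 * δ * phaseGrad m ε ξ η * (‖F η‖ ^ 2 * ‖G (η - ξ)‖ ^ 2) := by
      rw [amplitude, norm_mul, mul_pow, Complex.norm_real, Real.norm_eq_abs]
      calc _ ≤ c ^ 2 * (1536 * angular m ε η (η - ξ) * ‖F η‖ ^ 2 * ‖G (η - ξ)‖ ^ 2) := by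
            gcongr
            · exact hc _ _
            · exact norm_spinorInner_nullSymbol_sq_le hε j η (η - ξ) (F η) (G (η - ξ))
        _ ≤ c ^ 2 * (1536 * (δ * phaseGrad m ε ξ η) * ‖F η‖ ^ 2 * ‖G (η - ξ)‖ ^ 2) := by gcongr
        _ = _ := by ring
    have := ENNReal.ofReal_le_ofReal hreal
    rwa [ENNReal.ofReal_mul (by positivity), ENNReal.ofReal_mul (p := ‖F η‖ ^ 2) (by positivity),
      ENNReal.ofReal_pow (norm_nonneg _), ENNReal.ofReal_pow (norm_nonneg _),
      ENNReal.ofReal_pow (norm_nonneg _), ofReal_norm, ofReal_norm, ofReal_norm] at this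

theorem amplitude_ne_zero {χ : Cutoff} {m ε μ : ℝ} {j : Fin 3} {F G : E3 → Spinor} {ξ η : E3}
    (h : amplitude χ m ε μ j F G ξ η ≠ 0) : rho χ μ ‖ξ‖ ≠ 0 ∧ F η ≠ 0 ∧ G (η - ξ) ≠ 0 := by
  refine ⟨fun h0 => h ?_, fun h0 => h ?_, fun h0 => h ?_⟩
  · simp [amplitude, h0]
  · simp [amplitude, h0, spinorInner]
  · simp [amplitude, h0, spinorInner]

/-- Passage from the frequency side to the space-time bound. -/
theorem L2Bound_waveNullForm {χ : Cutoff} {m ε μ κ A B : ℝ} (hε : ε = 1 ∨ ε = -1) (hμ : 1 ≤ μ)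
    {j : Fin 3} {f g : L2} {F G : E3 → Spinor}
    (hF : hat f =ᵐ[volume] F) (hG : hat g =ᵐ[volume] G)
    (hd : Dominated m ε κ F G (amplitude χ m ε μ j F G)) (hA : 0 ≤ A) (hB : 0 ≤ B)
    (hosc : ∫⁻ η, ‖F η‖ₑ ^ 2 ≠ ⊤ → ∫⁻ η, ‖G η‖ₑ ^ 2 ≠ ⊤ →
      ∫⁻ p : ℝ × E3, ‖oscillatory m ε (amplitude χ m ε μ j F G) p.1 p.2‖ₑ ^ 2 ≤
        ENNReal.ofReal A * ((∫⁻ η, ‖F η‖ₑ ^ 2) * ∫⁻ η, ‖G η‖ₑ ^ 2))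
    (hAB : (2 * Real.pi) ^ 3 * A ≤ B ^ 2) :
    L2Bound (waveNullForm χ m ε μ j f g) (B * ‖f‖ * ‖g‖) := by
  have hpi := Real.two_pi_pos
  have hval : ∀ {f : L2} {F : E3 → Spinor}, hat f =ᵐ[volume] F →
      ∫⁻ η, ‖F η‖ₑ ^ 2 = ENNReal.ofReal ((2 * Real.pi) ^ 3 * ‖f‖ ^ 2) := fun {f F} h => by
    rw [ENNReal.ofReal_mul (by positivity), ENNReal.ofReal_pow (norm_nonneg _), ofReal_norm,
      ← lintegral_enorm_hat_sq]
    exact lintegral_congr_ae (h.symm.mono fun η e => by simp only [e])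
  have hFt : ∫⁻ η, ‖F η‖ₑ ^ 2 ≠ ⊤ := by rw [hval hF]; exact ENNReal.ofReal_ne_top
  have hGt : ∫⁻ η, ‖G η‖ₑ ^ 2 ≠ ⊤ := by rw [hval hG]; exact ENNReal.ofReal_ne_top
  have hVm : Measurable fun p : ℝ × E3 =>
      oscillatory m ε (amplitude χ m ε μ j F G) p.1 p.2 := measurable_oscillatory hd.measurable
  have hu : waveNullForm χ m ε μ j f g =
      fun p => invFourier (oscillatory m ε (amplitude χ m ε μ j F G) p.1) p.2 :=
    funext fun p => waveNullForm_eq χ m ε μ j f g hF hG p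
  obtain ⟨b, hb⟩ := hd.norm_oscillatory_bounded hε hFt hGt
  have hsupp : ∀ t ξ, oscillatory m ε (amplitude χ m ε μ j F G) t ξ ≠ 0 → ‖ξ‖ ≤ 2 * μ := by
    intro t ξ h0
    by_contra hc
    refine h0 ?_
    have : ∀ η, amplitude χ m ε μ j F G ξ η = 0 := fun η => by
      by_contra h
      exact hc (rho_support χ hμ (norm_nonneg ξ) (amplitude_ne_zero h).1).1
    simp [oscillatory, this]
  have hle : eLpNorm (waveNullForm χ m ε μ j f g) 2 volume ≤ ENNReal.ofReal (B * ‖f‖ * ‖g‖) := by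
    refine (ENNReal.pow_le_pow_left_iff two_ne_zero).1 ?_
    rw [eLpNorm_two_sq, hu, lintegral_invFourier_sq hVm hb hsupp]
    calc _ ≤ ENNReal.ofReal (((2 * Real.pi) ^ 3)⁻¹) * (ENNReal.ofReal A *
          ((∫⁻ η, ‖F η‖ₑ ^ 2) * ∫⁻ η, ‖G η‖ₑ ^ 2)) := by
          gcongr
          exact hosc hFt hGt
      -- Each `hat` contributes `(2π)³` and the inverse transform `(2π)⁻³`, which leaves `(2π)³`.
      _ = ENNReal.ofReal (((2 * Real.pi) ^ 3 * A) * (‖f‖ * ‖g‖) ^ 2) := by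
          rw [hval hF, hval hG, ← ENNReal.ofReal_mul (by positivity),
            ← ENNReal.ofReal_mul (by positivity), ← ENNReal.ofReal_mul (by positivity)]
          congr 1
          field_simp
      _ ≤ _ := by
          rw [← ENNReal.ofReal_pow (by positivity)]
          refine ENNReal.ofReal_le_ofReal ?_
          calc _ ≤ B ^ 2 * (‖f‖ * ‖g‖) ^ 2 := by gcongr
            _ = _ := by ring
  refine ⟨⟨?_, hle.trans_lt ENNReal.ofReal_lt_top⟩, hle⟩
  rw [hu]
  exact (measurable_invFourier_uncurry hVm).aestronglyMeasurable

/-! ### The two dyadic estimates -/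

theorem mem_cube_of_norm_le {x : E3} {r : ℝ} (hx : ‖x‖ ≤ r) (y : E3) :
    y + x ∈ cube (y - WithLp.toLp 2 fun _ => r) (2 * r) := by
  intro k
  have := abs_le.1 ((PiLp.norm_apply_le x k).trans hx)
  simp only [PiLp.add_apply, PiLp.sub_apply]
  constructor <;> linarith [this.1, this.2]

/-- The shells bound the brackets below by `l₁/2` and `l₂/2`, so that `θ l₁² ≤ 8Kμ²`. If `l₁ = 1` or
`l₂ = 1` there is no such lower bound, but then `l₁ ≤ K`, the right-hand side is at least `16`, and
`θ ≤ 2` suffices. -/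
theorem angular_one_le_of_shell {m K μ l₁ l₂ : ℝ} (hK : 1 < K) (hμ : 1 ≤ μ) (h₁ : 1 ≤ l₁)
    (h₂ : 1 ≤ l₂) (hl : l₁ ≤ K * l₂) {ξ η : E3} (hξ : ‖ξ‖ ≤ 2 * μ) (hη : η ∈ shell l₁)
    (hζ : η - ξ ∈ shell l₂) : angular m 1 η (η - ξ) ≤ (4 * K * (μ / l₁)) ^ 2 := by
  have hl0 : 0 < l₁ := by linarith
  have h2 := angular_le_two (m := m) (Or.inl rfl : (1 : ℝ) = 1 ∨ (1 : ℝ) = -1) η (η - ξ)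
  have h0 := angular_nonneg (m := m) (Or.inl rfl : (1 : ℝ) = 1 ∨ (1 : ℝ) = -1) η (η - ξ)
  have htriv : l₁ ≤ K → angular m 1 η (η - ξ) ≤ (4 * K * (μ / l₁)) ^ 2 := fun hlK => by
    have : 4 ≤ 4 * K * (μ / l₁) := by
      rw [← mul_div_assoc, le_div_iff₀ hl0]
      nlinarith
    nlinarith
  rcases h₁.eq_or_lt with e | h₁'
  · exact htriv (by linarith)
  rcases h₂.eq_or_lt with e | h₂'
  · exact htriv (by rw [← e, mul_one] at hl; exact hl)
  have hb1 : l₁ ≤ 2 * bracket m η := (hη.2 h₁').trans (by linarith [norm_le_bracket m η])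
  have hb2 : l₂ ≤ 2 * bracket m (η - ξ) :=
    (hζ.2 h₂').trans (by linarith [norm_le_bracket m (η - ξ)])
  have key := angular_one_mul_bracket_le m ξ η
  have hprod : l₁ ^ 2 ≤ K * (2 * (2 * bracket m η * bracket m (η - ξ))) := by
    calc l₁ ^ 2 ≤ K * (l₁ * l₂) := by nlinarith
      _ ≤ K * ((2 * bracket m η) * (2 * bracket m (η - ξ))) := by
          gcongr
          linarith
      _ = _ := by ring
  have hξ2 : ‖ξ‖ ^ 2 ≤ (2 * μ) ^ 2 := by gcongr
  have : angular m 1 η (η - ξ) * l₁ ^ 2 ≤ 8 * K * μ ^ 2 := by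
    calc _ ≤ angular m 1 η (η - ξ) * (K * (2 * (2 * bracket m η * bracket m (η - ξ)))) := by gcongr
      _ = 2 * K * (angular m 1 η (η - ξ) * (2 * bracket m η * bracket m (η - ξ))) := by ring
      _ ≤ 2 * K * (2 * μ) ^ 2 := by gcongr; exact key.trans hξ2
      _ = _ := by ring
  rw [mul_pow, div_pow, ← mul_div_assoc, le_div_iff₀ (by positivity)]
  refine this.trans ?_
  nlinarith [sq_nonneg μ, mul_nonneg (sq_nonneg μ) (by linarith : (0 : ℝ) ≤ K)]

section Estimates

variable {χ : Cutoff} {m ε μ l₁ l₂ c : ℝ} {j : Fin 3}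

theorem mem_shell_of_amplitude_ne_zero {F G : E3 → Spinor} {ξ η : E3}
    (h : amplitude χ m ε μ j ((shell l₁).indicator F) ((shell l₂).indicator G) ξ η ≠ 0) :
    η ∈ shell l₁ ∧ η - ξ ∈ shell l₂ := by
  obtain ⟨-, h1, h2⟩ := amplitude_ne_zero h
  exact ⟨Set.mem_of_indicator_ne_zero h1, Set.mem_of_indicator_ne_zero h2⟩

/-- The bound by the smaller input frequency. -/
theorem L2Bound_waveNullForm_min (hε : ε = 1 ∨ ε = -1) (hc : ∀ l s, |rho χ l s| ≤ c)
    (hμ : 1 ≤ μ) (h₁ : 1 ≤ l₁) (h₂ : 1 ≤ l₂) (f g : L2) {C : ℝ} (hC : 0 ≤ C)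
    (hCS : (2 * Real.pi) ^ 4 * (1536 * 192 * c ^ 2) ≤ C ^ 2) :
    L2Bound (waveNullForm χ m ε μ j (freqProj χ l₁ f) (freqProj χ l₂ g))
      (C * min l₁ l₂ * ‖freqProj χ l₁ f‖ * ‖freqProj χ l₂ g‖) := by
  set l := min l₁ l₂ with hl
  have hl1 : 1 ≤ l := le_min h₁ h₂
  have hd := dominated_amplitude (χ := χ) (m := m) (μ := μ) hε j
    ((measurable_hat (freqProj χ l₁ f)).indicator (measurableSet_shell l₁))
    ((measurable_hat (freqProj χ l₂ g)).indicator (measurableSet_shell l₂)) hc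
    (δ := 2) (by norm_num) fun ξ η _ => (angular_le_two hε η (η - ξ)).trans (by norm_num)
  have hcube : ∃ p : E3 → E3, ∀ ξ η, amplitude χ m ε μ j
      ((shell l₁).indicator (hat (freqProj χ l₁ f)))
      ((shell l₂).indicator (hat (freqProj χ l₂ g))) ξ η ≠ 0 → η ∈ cube (p ξ) (2 * (2 * l)) := by
    -- The smaller frequency confines `η` to a ball of radius `2l`, about `0` if it belongs to `f`
    -- and about `ξ` if it belongs to `g`.
    rcases le_total l₁ l₂ with h | h
    · refine ⟨fun _ => 0 - WithLp.toLp 2 fun _ => 2 * l, fun ξ η h0 => ?_⟩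
      have hη := (mem_shell_of_amplitude_ne_zero h0).1.1
      rw [hl, min_eq_left h]
      simpa using mem_cube_of_norm_le hη 0
    · refine ⟨fun ξ => ξ - WithLp.toLp 2 fun _ => 2 * l, fun ξ η h0 => ?_⟩
      have hη := (mem_shell_of_amplitude_ne_zero h0).2.1
      rw [hl, min_eq_right h]
      simpa using mem_cube_of_norm_le hη ξ
  obtain ⟨p, hp⟩ := hcube
  refine L2Bound_waveNullForm hε hμ (hat_freqProj_ae_eq_indicator χ h₁ f)
    (hat_freqProj_ae_eq_indicator χ h₂ g) hd
    (A := 2 * Real.pi * (1536 * c ^ 2 * 2 * (6 * (2 * (2 * l)) ^ 2)))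
    (by positivity) (by positivity)
    (fun hF hG => hd.lintegral_oscillatory_sq_le hε hF hG (by positivity) hp) ?_
  calc _ = (2 * Real.pi) ^ 4 * (1536 * 192 * c ^ 2) * l ^ 2 := by ring
    _ ≤ C ^ 2 * l ^ 2 := by gcongr
    _ = _ := by ring

/-- The bound by the output frequency, with a gain from the null symbol. -/
theorem L2Bound_waveNullForm_output (hε : ε = 1 ∨ ε = -1) (hc : ∀ l s, |rho χ l s| ≤ c)
    (hμ : 1 ≤ μ) (h₁ : 1 ≤ l₁) (h₂ : 1 ≤ l₂) (f g : L2) {δ B : ℝ} (hδ : 0 ≤ δ) (hB : 0 ≤ B)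
    (hang : ∀ ξ η : E3, ‖ξ‖ ≤ 2 * μ → η ∈ shell l₁ → η - ξ ∈ shell l₂ →
      angular m ε η (η - ξ) ≤ δ ^ 2)
    (hBS : (2 * Real.pi) ^ 4 * (1536 * 750 * c ^ 2) * (δ * μ ^ 2) ≤ B ^ 2) :
    L2Bound (waveNullForm χ m ε μ j (freqProj χ l₁ f) (freqProj χ l₂ g))
      (B * ‖freqProj χ l₁ f‖ * ‖freqProj χ l₂ g‖) := by
  have hξ : ∀ {F G : E3 → Spinor} (ξ η : E3), amplitude χ m ε μ j F G ξ η ≠ 0 → ‖ξ‖ ≤ 2 * μ :=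
    fun ξ η h0 => (rho_support χ hμ (norm_nonneg ξ) (amplitude_ne_zero h0).1).1
  have hd := dominated_amplitude (χ := χ) (m := m) (μ := μ) hε j
    ((measurable_hat (freqProj χ l₁ f)).indicator (measurableSet_shell l₁))
    ((measurable_hat (freqProj χ l₂ g)).indicator (measurableSet_shell l₂)) hc hδ
    fun ξ η h0 => hang ξ η (hξ ξ η h0) (mem_shell_of_amplitude_ne_zero h0).1
      (mem_shell_of_amplitude_ne_zero h0).2
  refine L2Bound_waveNullForm hε hμ (hat_freqProj_ae_eq_indicator χ h₁ f)
    (hat_freqProj_ae_eq_indicator χ h₂ g) hd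
    (A := 125 * (2 * Real.pi * (1536 * c ^ 2 * δ * (6 * μ ^ 2))))
    (by positivity) hB
    (fun hF hG => hd.lintegral_oscillatory_sq_le_of_output hε hF hG (by linarith) hξ
      fun ξ η h0 => (mem_shell_of_amplitude_ne_zero h0).1.1) ?_
  exact le_trans (le_of_eq (by ring)) hBS

end Estimates

end DiracNull

end

open DiracNull in
theorem lemma4p2 (χ : Cutoff) (m : ℝ) (hm : 0 ≤ m) (K : ℝ) (hK : 1 < K) :
    ∃ C : ℝ, 0 < C ∧ ∀ μ l₁ l₂ : ℝ, IsDyadic μ → IsDyadic l₁ → IsDyadic l₂ →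
      1 ≤ μ → 1 ≤ l₁ → 1 ≤ l₂ → ∀ (j : Fin 3) (f g : L2),
      ((NotComparable K l₁ l₂ →
          L2Bound (waveNullForm χ m 1 μ j (freqProj χ l₁ f) (freqProj χ l₂ g))
            (C * (min l₁ l₂) * ‖freqProj χ l₁ f‖ * ‖freqProj χ l₂ g‖)) ∧
       (Lesssim K μ l₁ → Comparable K l₁ l₂ →
          L2Bound (waveNullForm χ m 1 μ j (freqProj χ l₁ f) (freqProj χ l₂ g))
            (C * (μ * (μ / l₁) ^ (1 / 2 : ℝ)) * ‖freqProj χ l₁ f‖ * ‖freqProj χ l₂ g‖))) ∧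
      ((NotComparable K l₁ l₂ →
          L2Bound (waveNullForm χ m (-1) μ j (freqProj χ l₁ f) (freqProj χ l₂ g))
            (C * (min l₁ l₂) * ‖freqProj χ l₁ f‖ * ‖freqProj χ l₂ g‖)) ∧
       (Lesssim K μ l₁ → Comparable K l₁ l₂ →
          L2Bound (waveNullForm χ m (-1) μ j (freqProj χ l₁ f) (freqProj χ l₂ g))
            (C * μ * ‖freqProj χ l₁ f‖ * ‖freqProj χ l₂ g‖))) := by
  obtain ⟨c, hc0, hc⟩ := exists_abs_rho_le χ
  have hpi := Real.pi_pos
  have hK0 : 0 < K := by linarith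
  -- The (++) output bound is the most demanding: `δ = 4K μ/l₁` turns `750` into `3000 K`. The other
  -- cases need `192` and `750 · 2`.
  set S : ℝ := (2 * Real.pi) ^ 4 * (1536 * 3000 * c ^ 2) * K with hS
  have hS0 : 0 < S := by positivity
  have hSS : √S ^ 2 = S := Real.sq_sqrt hS0.le
  have hbase : (2 * Real.pi) ^ 4 * (1536 * 3000 * c ^ 2) ≤ S :=
    le_mul_of_one_le_right (by positivity) hK.le
  have hmin : (2 * Real.pi) ^ 4 * (1536 * 192 * c ^ 2) ≤ √S ^ 2 := by
    rw [hSS]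
    refine le_trans ?_ hbase
    gcongr
    norm_num
  refine ⟨√S, Real.sqrt_pos.2 hS0, fun μ l₁ l₂ _ _ _ hμ h₁ h₂ j f g =>
    ⟨⟨fun _ => ?_, fun _ hcomp => ?_⟩, ⟨fun _ => ?_, fun _ _ => ?_⟩⟩⟩
  · exact L2Bound_waveNullForm_min (Or.inl rfl) hc hμ h₁ h₂ f g (Real.sqrt_nonneg _) hmin
  · have hq : 0 ≤ μ / l₁ := by positivity
    refine L2Bound_waveNullForm_output (Or.inl rfl) hc hμ h₁ h₂ f g (δ := 4 * K * (μ / l₁))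
      (by positivity) (by positivity)
      (fun ξ η hξ hη hζ => angular_one_le_of_shell hK hμ h₁ h₂ hcomp.1 hξ hη hζ) ?_
    -- Both sides are multiples of `μ³/l₁`, with equal constants by the choice of `S`.
    rw [mul_pow (√S), hSS, mul_pow μ, ← Real.sqrt_eq_rpow, Real.sq_sqrt hq, hS]
    exact le_of_eq (by ring)
  · exact L2Bound_waveNullForm_min (Or.inr rfl) hc hμ h₁ h₂ f g (Real.sqrt_nonneg _) hmin
  · refine L2Bound_waveNullForm_output (Or.inr rfl) hc hμ h₁ h₂ f g (δ := 2)
      (by norm_num) (by positivity)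
      (fun ξ η _ _ _ => (angular_le_two (Or.inr rfl) η (η - ξ)).trans (by norm_num)) ?_
    rw [mul_pow (√S), hSS]
    calc _ = (2 * Real.pi) ^ 4 * (1536 * 1500 * c ^ 2) * μ ^ 2 := by ring
      _ ≤ S * μ ^ 2 := by
        gcongr
        refine le_trans ?_ hbase
        gcongr
        norm_num
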